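/- For $n\ge 0$ let $|n\rangle=h_n\in L^2(\mathbb R)$ be the Hermite function $h_n(x)=(2^n n!)^{-1/2}\pi^{-1/4}H_n(x)e^{-x^2/2}$, where $H_n$ is the (physicists') Hermite polynomial of degree $n$, and let $\mathcal H^N=\mathrm{span}\{|n\rangle: 0\le n\le N\}$. For a linear subspace $\mathcal H\subseteq\mathcal H^N$ let $\mathcal D(\mathcal H)$ be the set of density matrices on $\mathcal H$, i.e. positive operators $\rho:\mathcal H\to\mathcal H$ with $\mathrm{tr}\,\rho=1$. With $K_\rho(x,y)=\sum_i(\rho e_i)(x)\overline{e_i(y)}$ the integral kernel of $\rho$ (where $(e_i)$ is an orthonormal basis of $\mathcal H$), the Wigner function of $\rho$ is $$W\rho(x,\xi)=\frac1{2\pi}\int_{\mathbb R}e^{-i\xi y}K_\rho\bigl(x+\tfrac y2,x-\tfrac y2\bigr)\,dy .$$ Let $$\mathcal D_+(\mathcal H)=\{\rho\in\mathcal D(\mathcal H): W\rho(z)\ge 0\text{ for all }z\in\mathbb R^2\},\qquad \mathcal D_{0+}(\mathcal H)=\{\rho\in\mathcal D_+(\mathcal H): W\rho(z)=0\text{ for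 some }z\in\mathbb R^2\}.$$ Let $N\ge 0$, let $\mathcal H\subseteq\mathcal H^N$ be a linear subspace, and let $\rho_0=|0\rangle\langle 0|$ be the orthogonal projector onto the span of $|0\rangle$. Then: 1. If $|0\rangle\in\mathcal H$, then $\mathcal D_+(\mathcal H)=\mathrm{conv}\bigl(\mathcal D_{0+}(\mathcal H)\cup\{\rho_0\}\bigr)$. 2. If $|0\rangle\notin\mathcal H$, then $\mathcal D_+(\mathcal H)=\mathrm{conv}\bigl(\mathcal D_{0+}(\mathcal H)\bigr)$. 3. If $\dim\mathcal H\ge 2$, then $\mathcal D_+(\mathcal H)=\overline{\mathrm{conv}}\bigl(\mathcal D_{0+}(\mathcal H)\bigr)$. Here $\mathrm{conv}$ is the convex hull and $\overline{\mathrm{conv}}(X)$ is the smallest convex set of operators on $\mathcal H$ that contains $X$ and is closed for the trace norm $\|A\|_1=\mathrm{tr}\sqrt{A^\dagger A}$; the (closed) convex hull of the empty set is empty. -/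

import Mathlib

open MeasureTheory
open scoped ComplexOrder InnerProductSpace

noncomputable section

namespace WignerPositive

/-! ### Hermite functions and Fock spaces -/

/-- The (physicists') Hermite polynomials: `H₀ = 1`, `H_{n+1} = 2 X H_n - H_n'`. -/
def hermitePoly : ℕ → Polynomial ℝ
  | 0 => 1
  | n + 1 => 2 * Polynomial.X * hermitePoly n - Polynomial.derivative (hermitePoly n)

/-- The Hermite function `h_n(x) = (2ⁿ n!)^{-1/2} π^{-1/4} H_n(x) e^{-x²/2}`. -/
def hermiteFun (n : ℕ) (x : ℝ) : ℂ :=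
  (((2 ^ n * (n.factorial : ℝ)) ^ (-(1 / 2) : ℝ) * Real.pi ^ (-(1 / 4) : ℝ) *
    (hermitePoly n).eval x * Real.exp (-(1 / 2) * x ^ 2) : ℝ) : ℂ)

lemma integrable_poly_mul_gaussian (p : Polynomial ℝ) :
    Integrable (fun x : ℝ => p.eval x * Real.exp (-1 * x ^ 2)) := by
  induction p using Polynomial.induction_on' with
  | add p q hp hq =>
    simp only [Polynomial.eval_add, add_mul]
    exact hp.add hq
  | monomial n a =>
    have h := (integrable_rpow_mul_exp_neg_mul_sq (b := 1) one_pos (s := n)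
      (by have : (0 : ℝ) ≤ n := n.cast_nonneg
          linarith)).const_mul a
    refine h.congr (Filter.Eventually.of_forall fun x => ?_)
    simp only [Polynomial.eval_monomial, Real.rpow_natCast]
    ring

lemma memLp_hermiteFun (n : ℕ) : MemLp (hermiteFun n) 2 (volume : Measure ℝ) := by
  have hc : Continuous (hermiteFun n) := by
    unfold hermiteFun
    fun_prop
  rw [memLp_two_iff_integrable_sq_norm hc.aestronglyMeasurable]
  have h := (integrable_poly_mul_gaussian (hermitePoly n ^ 2)).const_mul
    (((2 ^ n * (n.factorial : ℝ)) ^ (-(1 / 2) : ℝ) * Real.pi ^ (-(1 / 4) : ℝ)) ^ 2)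
  refine h.congr (Filter.Eventually.of_forall fun x => ?_)
  have he : Real.exp (-1 * x ^ 2) = Real.exp (-(1 / 2) * x ^ 2) ^ 2 := by
    rw [← Real.exp_nat_mul]
    congr 1
    push_cast
    ring
  simp only [hermiteFun, Complex.norm_real, Real.norm_eq_abs, sq_abs, Polynomial.eval_pow, he]
  ring

/-- The Hilbert space `L²(ℝ)` of complex-valued functions. -/
abbrev L2R : Type := Lp ℂ 2 (volume : Measure ℝ)

/-- The Fock state `|n⟩`, i.e. the Hermite function `h_n` as an element of `L²(ℝ)`. -/
def fock (n : ℕ) : L2R := (memLp_hermiteFun n).toLp (hermiteFun n)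

/-- The Hilbert space `𝓗^N = span {|n⟩ : 0 ≤ n ≤ N}`. -/
def fockSpace (N : ℕ) : Submodule ℂ L2R := Submodule.span ℂ (fock '' Set.Iic N)

instance finiteDimensional_fockSpace (N : ℕ) : FiniteDimensional ℂ (fockSpace N) :=
  FiniteDimensional.span_of_finite ℂ ((Set.finite_Iic N).image fock)

/-! ### Operators on a finite-dimensional Hilbert space

Every operator on a finite-dimensional Hilbert space `E` is trace class, so the space of
trace-class operators on `E` is `E →L[ℂ] E`. -/

section Operators

variable {E : Type*} [NormedAddCommGroup E] [InnerProductSpace ℂ E]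

/-- The trace of an operator on the finite-dimensional space `E`. -/
def tr (A : E →L[ℂ] E) : ℂ := LinearMap.trace ℂ E (A : E →ₗ[ℂ] E)

/-- The convex hull of a set of operators. -/
abbrev convHull (S : Set (E →L[ℂ] E)) : Set (E →L[ℂ] E) := convexHull ℝ S

variable [CompleteSpace E]

/-- The trace norm `‖A‖₁ = tr |A|`, where `|A| = √(A† A)`. -/
def traceNorm (A : E →L[ℂ] E) : ℝ := (tr (CFC.abs A)).re

/-- A set of operators is closed for the trace norm if it contains every operator that it
approximates in the trace norm. -/
def IsTraceNormClosed (C : Set (E →L[ℂ] E)) : Prop :=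
  ∀ ρ : E →L[ℂ] E, (∀ ε > 0, ∃ η ∈ C, traceNorm (ρ - η) < ε) → ρ ∈ C

/-- The closed convex hull for the trace norm: the smallest convex, trace-norm closed set of
operators that contains `S`. -/
def closedConvHull (S : Set (E →L[ℂ] E)) : Set (E →L[ℂ] E) :=
  ⋂₀ {C | S ⊆ C ∧ Convex ℝ C ∧ IsTraceNormClosed C}

variable (E) in
/-- `𝓐(E)`: the self-adjoint operators on `E` with unit trace. -/
def unitTraceOps : Set (E →L[ℂ] E) := {ρ | IsSelfAdjoint ρ ∧ tr ρ = 1}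

variable (E) in
/-- `𝓓(E)`: the density matrices on `E`. -/
def densityMatrices : Set (E →L[ℂ] E) := {ρ | ρ ∈ unitTraceOps E ∧ ρ.IsPositive}

end Operators

/-! ### Wigner functions and Wigner-positive states -/

section Wigner

variable (H : Submodule ℂ L2R) [FiniteDimensional ℂ H]

/-- The integral kernel `K_ρ(x, y) = ∑ᵢ (ρ eᵢ)(x) conj (eᵢ(y))` of an operator `ρ` on `H`,
where `(eᵢ)` is an orthonormal basis of `H`. -/
def kernel (ρ : H →L[ℂ] H) (x y : ℝ) : ℂ :=
  ∑ i, ((ρ (stdOrthonormalBasis ℂ H i) : H) : L2R) x *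
    (starRingEnd ℂ) ((stdOrthonormalBasis ℂ H i : L2R) y)

/-- The Wigner function
`Wρ(x, ξ) = (2π)⁻¹ ∫ e^{-iξy} K_ρ(x + y/2, x - y/2) dy`. It is real valued for self-adjoint `ρ`.
Its value at a point does not depend on the choice of representatives of classes in `L²(ℝ)`. -/
def wigner (ρ : H →L[ℂ] H) (z : ℝ × ℝ) : ℂ :=
  1 / (2 * Real.pi) * ∫ y : ℝ, Complex.exp (-(Complex.I * z.2 * y)) *
    kernel H ρ (z.1 + y / 2) (z.1 - y / 2)

/-- The nodal set of the Wigner function of `ρ`. -/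
def nodalSet (ρ : H →L[ℂ] H) : Set (ℝ × ℝ) := {z | wigner H ρ z = 0}

/-- `𝓓₊(H)`: the Wigner-positive states on `H`. (`0 ≤ w` for complex `w` means that `w` is real
and nonnegative.) -/
def wignerPositive : Set (H →L[ℂ] H) := {ρ | ρ ∈ densityMatrices H ∧ ∀ z, 0 ≤ wigner H ρ z}

/-- `𝓓₀₊(H)`: the Wigner-positive states on `H` with nonempty nodal set. -/
def wignerPositiveNodal : Set (H →L[ℂ] H) := {ρ | ρ ∈ wignerPositive H ∧ (nodalSet H ρ).Nonempty}

end Wigner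

end WignerPositive

end

/-!
A vector of the Fock space `fockSpace N` is a polynomial times the Gaussian `e^{-x²/2}`. For
`u = p(x) e^{-x²/2}` a contour shift (`integral_poly_mul_shifted_gaussian`) gives
`W(u, u)(x, ξ) = e^{-x²-ξ²} w(x - iξ)`, where the profile
`w(Z) = (2π)⁻¹ ∫ p(Z + s/2) conj (p(Z - s/2)) e^{-s²/4} ds` is continuous and grows like
`c |Z|^{2n}` with `n = deg p` and `c > 0` (`tendsto_wignerProfile`). All questions about signs and
zeros of Wigner functions become questions about real combinations of such profiles. Because the
leading coefficients are positive, nothing cancels at infinity in a mixture with nonnegative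
weights.

Two facts carry the proof.

* Hudson's theorem (`exists_crossWigner_gaussPoly_nonpos`): if `p` is not constant, the Wigner
  function of `p(x) e^{-x²/2}` has a nonpositive value. A Gaussian average of the Wigner function
  is the squared overlap with a coherent state, and as a function of the coherent state the overlap
  is, up to a nonvanishing factor, a polynomial of degree `deg p`, which has a root.
* The first zero (`exists_segment_nonneg_with_zero`): on the segment from a positive function to
  one that takes a negative value, but is asymptotically a nonnegative multiple of the first, there
  is a nonnegative function with a zero. It is found at the minimum of the quotient.

For the decomposition into states with a zero, diagonalize a Wigner-positive state,
`ρ = ∑ᵢ μᵢ |eᵢ⟩⟨eᵢ|`, and induct on the number of nonzero weights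
(`mem_convexHull_extremalWeights`). If the Wigner function has no zero and two weights are nonzero,
shift weight from one to the other, in both directions, until a zero appears or a weight vanishes;
`ρ` lies between the two endpoints. If one weight remains, the state is pure with a positive Wigner
function, so it is `|0⟩⟨0|` by Hudson's theorem.

If `H` contains `|0⟩` and a unit vector `ψ` orthogonal to it, then for small `θ > 0` the state
`cos²θ |0⟩⟨0| + sin²θ |ψ⟩⟨ψ|` has a positive Wigner function, and the pure state of
`cos θ |0⟩ + sin θ ψ` has not. Their profiles have the same order of growth, so the segment between
them contains a Wigner-positive state with a zero. As `θ → 0` these states converge to `|0⟩⟨0|`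
(`rankOne_fock_zero_mem_closure`), in the trace norm because it is equivalent to the operator norm.
-/

noncomputable section

namespace WignerPositive

/-! ### The cross-Wigner transform -/

/-- The cross-Wigner transform `W(u, v)(x, ξ) = (2π)⁻¹ ∫ e^{-iξy} u(x + y/2) conj (v(x - y/2)) dy`,
which is linear in `u` and conjugate linear in `v`. -/
def crossWigner (u v : L2R) (z : ℝ × ℝ) : ℂ :=
  1 / (2 * Real.pi) * ∫ y : ℝ, Complex.exp (-(Complex.I * z.2 * y)) *
    (u (z.1 + y / 2) * (starRingEnd ℂ) (v (z.1 - y / 2)))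

lemma ae_comp_affine {P : ℝ → Prop} (h : ∀ᵐ x, P x) (x : ℝ) {a : ℝ} (ha : a ≠ 0) :
    ∀ᵐ y : ℝ, P (x + a * y) := by
  have h1 : Measure.QuasiMeasurePreserving (fun y : ℝ => a * y) volume volume := by
    refine ⟨measurable_const_mul a, ?_⟩
    rw [Real.map_volume_mul_left ha]
    exact Measure.smul_absolutelyContinuous
  have h2 := ((measurePreserving_add_left volume x).quasiMeasurePreserving.comp h1)
  exact h2.ae h

lemma memLp_comp_affine (u : L2R) (x : ℝ) {a : ℝ} (ha : a ≠ 0) :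
    MemLp (fun y : ℝ => u (x + a * y)) 2 volume := by
  have hm : StronglyMeasurable (fun y : ℝ => u (x + a * y)) :=
    (Lp.stronglyMeasurable u).comp_measurable (by fun_prop)
  rw [memLp_two_iff_integrable_sq_norm hm.aestronglyMeasurable]
  have h := (memLp_two_iff_integrable_sq_norm (Lp.stronglyMeasurable u).aestronglyMeasurable).1
    (Lp.memLp u)
  exact (h.comp_add_left x).comp_mul_left' ha

lemma integrable_wignerProduct (u v : L2R) (x : ℝ) :
    Integrable (fun y : ℝ => u (x + y / 2) * (starRingEnd ℂ) (v (x - y / 2))) := by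
  have hu := memLp_comp_affine u x (a := 1 / 2) (by norm_num)
  have hv := (memLp_comp_affine v x (a := -(1 / 2)) (by norm_num)).star
  refine (hu.integrable_mul hv).congr (Filter.Eventually.of_forall fun y => ?_)
  simp only [Pi.mul_apply, Pi.star_apply]
  rw [show x + 1 / 2 * y = x + y / 2 by ring, show x + -(1 / 2) * y = x - y / 2 by ring]
  rfl

lemma norm_cexp_neg_I_mul_mul (a y : ℝ) : ‖Complex.exp (-(Complex.I * a * y))‖ = 1 := by
  rw [show -(Complex.I * a * y) = ((-(a * y) : ℝ) : ℂ) * Complex.I by push_cast; ring]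
  exact Complex.norm_exp_ofReal_mul_I _

lemma integrable_wignerIntegrand (u v : L2R) (x ξ : ℝ) :
    Integrable (fun y : ℝ => Complex.exp (-(Complex.I * ξ * y)) *
      (u (x + y / 2) * (starRingEnd ℂ) (v (x - y / 2)))) := by
  refine (integrable_wignerProduct u v x).bdd_mul (c := 1) ?_ ?_
  · exact Continuous.aestronglyMeasurable (by fun_prop)
  · exact Filter.Eventually.of_forall fun y => (norm_cexp_neg_I_mul_mul ξ y).le

lemma crossWigner_congr {u v : L2R} {f g : ℝ → ℂ} (hu : u =ᵐ[volume] f) (hv : v =ᵐ[volume] g)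
    (z : ℝ × ℝ) : crossWigner u v z =
      1 / (2 * Real.pi) * ∫ y : ℝ, Complex.exp (-(Complex.I * z.2 * y)) *
        (f (z.1 + y / 2) * (starRingEnd ℂ) (g (z.1 - y / 2))) := by
  unfold crossWigner
  congr 1
  refine integral_congr_ae ?_
  filter_upwards [ae_comp_affine hu z.1 (a := 1 / 2) (by norm_num),
    ae_comp_affine hv z.1 (a := -(1 / 2)) (by norm_num)] with y h1 h2
  rw [show z.1 + 1 / 2 * y = z.1 + y / 2 by ring] at h1
  rw [show z.1 + -(1 / 2) * y = z.1 - y / 2 by ring] at h2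
  rw [h1, h2]

lemma crossWigner_add_left (u u' v : L2R) (z : ℝ × ℝ) :
    crossWigner (u + u') v z = crossWigner u v z + crossWigner u' v z := by
  rw [crossWigner_congr (Lp.coeFn_add u u') Filter.EventuallyEq.rfl, crossWigner, crossWigner,
    ← mul_add, ← integral_add (integrable_wignerIntegrand u v _ _)
      (integrable_wignerIntegrand u' v _ _)]
  congr 1
  refine integral_congr_ae (.of_forall fun y => ?_)
  simp only [Pi.add_apply]
  ring

lemma crossWigner_smul_left (c : ℂ) (u v : L2R) (z : ℝ × ℝ) :
    crossWigner (c • u) v z = c * crossWigner u v z := by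
  rw [crossWigner_congr (Lp.coeFn_smul c u) Filter.EventuallyEq.rfl, crossWigner,
    mul_left_comm, ← integral_const_mul c]
  congr 1
  refine integral_congr_ae (.of_forall fun y => ?_)
  simp only [Pi.smul_apply, smul_eq_mul]
  ring

lemma conj_crossWigner (u v : L2R) (z : ℝ × ℝ) :
    (starRingEnd ℂ) (crossWigner u v z) = crossWigner v u z := by
  unfold crossWigner
  rw [map_mul, ← integral_conj, ← integral_neg_eq_self]
  congr 1
  · simp [map_ofNat]
  · congr 1
    ext y
    simp only [map_mul, ← Complex.exp_conj, map_neg, Complex.conj_I, Complex.conj_ofReal,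
      Complex.conj_conj, Complex.ofReal_neg, neg_div, sub_neg_eq_add, ← sub_eq_add_neg]
    ring_nf

/-- The cross-Wigner transform at a point, as a sesquilinear form on `L²(ℝ)`. -/
def crossWignerForm (z : ℝ × ℝ) : L2R →ₗ[ℂ] L2R →ₗ⋆[ℂ] ℂ :=
  LinearMap.mk₂'ₛₗ (RingHom.id ℂ) (starRingEnd ℂ) (fun u v => crossWigner u v z)
    (fun u u' v => crossWigner_add_left u u' v z)
    (fun c u v => crossWigner_smul_left c u v z)
    (fun u v v' => by
      rw [← conj_crossWigner, crossWigner_add_left, map_add, conj_crossWigner, conj_crossWigner])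
    (fun c u v => by
      rw [← conj_crossWigner, crossWigner_smul_left, map_mul, conj_crossWigner, smul_eq_mul])

lemma crossWignerForm_apply (z : ℝ × ℝ) (u v : L2R) :
    crossWignerForm z u v = crossWigner u v z := rfl

lemma crossWigner_self_im (u : L2R) (z : ℝ × ℝ) : (crossWigner u u z).im = 0 :=
  Complex.conj_eq_iff_im.1 (conj_crossWigner u u z)

section Operators

variable (H : Submodule ℂ L2R) [FiniteDimensional ℂ H]

lemma wigner_eq_sum (ρ : H →L[ℂ] H) (z : ℝ × ℝ) :
    wigner H ρ z = ∑ i, crossWigner (ρ (stdOrthonormalBasis ℂ H i) : H)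
      (stdOrthonormalBasis ℂ H i : H) z := by
  simp only [wigner, kernel, crossWigner]
  rw [← Finset.mul_sum, ← integral_finsetSum _ fun i _ => integrable_wignerIntegrand _ _ _ _]
  simp only [Finset.mul_sum]

/-- The Wigner function at a point, as a linear functional of the operator. -/
def wignerLin (z : ℝ × ℝ) : (H →L[ℂ] H) →ₗ[ℂ] ℂ where
  toFun ρ := wigner H ρ z
  map_add' ρ σ := by
    simp only [wigner_eq_sum, ← crossWignerForm_apply, add_apply,
      Submodule.coe_add, map_add, LinearMap.add_apply, Finset.sum_add_distrib]
  map_smul' c ρ := by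
    simp only [wigner_eq_sum, ← crossWignerForm_apply, smul_apply,
      Submodule.coe_smul, map_smul, LinearMap.smul_apply, Finset.smul_sum, RingHom.id_apply]

lemma wignerLin_apply (z : ℝ × ℝ) (ρ : H →L[ℂ] H) : wignerLin H z ρ = wigner H ρ z := rfl

/-- The Wigner function of `|u⟩⟨v|` does not depend on the space `H` that contains `u` and `v`. -/
lemma wigner_rankOne (u v : H) (z : ℝ × ℝ) :
    wigner H (InnerProductSpace.rankOne ℂ u v) z = crossWigner (u : L2R) (v : L2R) z := by
  have hv : (v : L2R) = ∑ i, ⟪stdOrthonormalBasis ℂ H i, v⟫_ℂ •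
      (stdOrthonormalBasis ℂ H i : L2R) := by
    conv_lhs => rw [← (stdOrthonormalBasis ℂ H).sum_repr' v]
    simp
  rw [wigner_eq_sum, hv, ← crossWignerForm_apply, map_sum]
  refine Finset.sum_congr rfl fun i _ => ?_
  rw [InnerProductSpace.rankOne_apply, ← crossWignerForm_apply, Submodule.coe_smul, map_smul,
    LinearMap.smul_apply, LinearMap.map_smulₛₗ]
  exact congrArg (· • _) (inner_conj_symm (𝕜 := ℂ) v (stdOrthonormalBasis ℂ H i)).symm

end Operators

/-! ### Gaussian integrals of polynomials -/

lemma integrable_poly_mul_cexp_quadratic (p : Polynomial ℂ) {b : ℝ} (hb : 0 < b) (β : ℂ) :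
    Integrable (fun y : ℝ => p.eval (y : ℂ) * Complex.exp (-b * y ^ 2 + β * y)) := by
  induction p using Polynomial.induction_on' with
  | add p q hp hq =>
    simp only [Polynomial.eval_add, add_mul]
    exact hp.add hq
  | monomial n a =>
    have h := ((integrable_rpow_mul_exp_neg_mul_sq (b := b / 2) (by positivity) (s := n)
      (by have : (0 : ℝ) ≤ n := n.cast_nonneg
          linarith)).ofReal (𝕜 := ℂ)).const_mul a
    have h2 := h.bdd_mul (f := fun y : ℝ => Complex.exp (-(b / 2) * y ^ 2 + β * y))
      (c := Real.exp (β.re ^ 2 / (2 * b)))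
      (Continuous.aestronglyMeasurable (by fun_prop))
      (Filter.Eventually.of_forall fun y => by
        rw [Complex.norm_exp]
        have : (-(b / 2) * (y : ℂ) ^ 2 + β * y).re = -(b / 2) * y ^ 2 + β.re * y := by
          rw [show (-(b / 2) * (y : ℂ) ^ 2 + β * y) = ((-(b / 2) * y ^ 2 : ℝ) : ℂ) + β * y by
            push_cast; ring]
          simp only [Complex.add_re, Complex.ofReal_re, Complex.re_mul_ofReal]
        rw [this, Real.exp_le_exp, le_div_iff₀ (by positivity)]
        nlinarith [sq_nonneg (b * y - β.re)])
    refine h2.congr (Filter.Eventually.of_forall fun y => ?_)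
    simp only [Polynomial.eval_monomial, Real.rpow_natCast, RCLike.ofReal_mul, RCLike.ofReal_pow,
      Complex.coe_algebraMap, Complex.ofReal_exp]
    rw [show (-b * (y : ℂ) ^ 2 + β * y) = (-(b / 2) * y ^ 2 + β * y) +
      ((-(b / 2) * y ^ 2 : ℝ) : ℂ) by push_cast; ring,
      Complex.exp_add (-(b / 2) * (y : ℂ) ^ 2 + β * y)]
    ring

lemma integrable_poly_mul_shifted_gaussian (p : Polynomial ℂ) {b : ℝ} (hb : 0 < b) (c : ℂ) :
    Integrable (fun y : ℝ => p.eval (y + c) * Complex.exp (-b * (y + c) ^ 2)) := by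
  have h := (integrable_poly_mul_cexp_quadratic (p.comp (Polynomial.X + Polynomial.C c)) hb
    (-2 * b * c)).mul_const (Complex.exp (-b * c ^ 2))
  refine h.congr (Filter.Eventually.of_forall fun y => ?_)
  simp only [Polynomial.eval_comp, Polynomial.eval_add, Polynomial.eval_X, Polynomial.eval_C]
  rw [mul_assoc, ← Complex.exp_add]
  ring_nf

/-- Integration by parts against a shifted Gaussian. -/
lemma integral_derivative_mul_shifted_gaussian (p : Polynomial ℂ) {b : ℝ} (hb : 0 < b) (c : ℂ) :
    ∫ y : ℝ, (Polynomial.derivative p).eval (y + c) * Complex.exp (-b * (y + c) ^ 2) =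
      2 * b * ∫ y : ℝ, (p * Polynomial.X).eval (y + c) * Complex.exp (-b * (y + c) ^ 2) := by
  rw [← integral_const_mul, ← sub_eq_zero,
    ← integral_sub (integrable_poly_mul_shifted_gaussian _ hb c)
      ((integrable_poly_mul_shifted_gaussian _ hb c).const_mul _)]
  refine integral_eq_zero_of_hasDerivAt_of_integrable
    (f := fun y : ℝ => p.eval (y + c) * Complex.exp (-b * (y + c) ^ 2)) (fun y => ?_)
    ((integrable_poly_mul_shifted_gaussian _ hb c).sub
      ((integrable_poly_mul_shifted_gaussian _ hb c).const_mul _))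
    (integrable_poly_mul_shifted_gaussian _ hb c)
  have h1 : HasDerivAt (fun y : ℝ => (y : ℂ) + c) 1 y :=
    (Complex.ofRealCLM.hasDerivAt (x := y)).add_const c
  have h2 : HasDerivAt (fun y : ℝ => p.eval (y + c)) ((Polynomial.derivative p).eval (y + c)) y := by
    have h := (p.hasDerivAt (y + c)).comp y h1
    rwa [mul_one] at h
  have h3 := ((h1.pow 2).const_mul (-b : ℂ)).cexp
  refine (h2.mul h3).congr_deriv ?_
  simp
  ring

/-- The contour of a Gaussian integral of a polynomial can be moved by any complex number. -/
lemma integral_poly_mul_shifted_gaussian (p : Polynomial ℂ) {b : ℝ} (hb : 0 < b) (c : ℂ) :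
    ∫ y : ℝ, p.eval (y + c) * Complex.exp (-b * (y + c) ^ 2) =
      ∫ y : ℝ, p.eval (y : ℂ) * Complex.exp (-b * y ^ 2) := by
  -- Both sides are linear in `p` and satisfy the same two-step recursion on the powers of `X`.
  have hX : ∀ n : ℕ, ∀ c : ℂ,
      ∫ y : ℝ, (Polynomial.X ^ n : Polynomial ℂ).eval (y + c) * Complex.exp (-b * (y + c) ^ 2) =
        ∫ y : ℝ, (Polynomial.X ^ n : Polynomial ℂ).eval ((y : ℂ) + 0) *
          Complex.exp (-b * ((y : ℂ) + 0) ^ 2) := by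
    intro n
    induction n using Nat.strong_induction_on with
    | _ n ih =>
      intro c
      rcases n with _ | n
      · have h : ∀ c : ℂ, ∫ y : ℝ, Complex.exp (-b * (y + c) ^ 2) = (Real.pi / b) ^ (1 / 2 : ℂ) := by
          intro c
          have h0 := fourierIntegral_gaussian (b := (b : ℂ)) (by simpa using hb)
            (2 * b * c * Complex.I)
          calc ∫ y : ℝ, Complex.exp (-b * (y + c) ^ 2)
              = ∫ y : ℝ, Complex.exp (-b * c ^ 2) * (Complex.exp (Complex.I *
                  (2 * b * c * Complex.I) * y) * Complex.exp (-b * y ^ 2)) := by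
                refine integral_congr_ae (.of_forall fun y => ?_)
                simp only [← Complex.exp_add]
                congr 1
                linear_combination (-2 * b * c * y) * Complex.I_sq
            _ = (Real.pi / b) ^ (1 / 2 : ℂ) := by
                rw [integral_const_mul, h0, mul_left_comm, ← Complex.exp_add]
                have hb' : (b : ℂ) ≠ 0 := by exact_mod_cast hb.ne'
                have : -b * c ^ 2 + -(2 * b * c * Complex.I) ^ 2 / (4 * b) = 0 := by
                  have e : (2 * b * c * Complex.I) ^ 2 = -(4 * b * (b * c ^ 2)) := by
                    linear_combination (4 * b ^ 2 * c ^ 2) * Complex.I_sq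
                  rw [e, neg_neg, mul_div_cancel_left₀ _ (by simpa using hb')]
                  ring
                rw [this, Complex.exp_zero, mul_one]
        simp only [pow_zero, Polynomial.eval_one, one_mul, h]
      · have hb' : (2 * b : ℂ) ≠ 0 := by
          simpa using hb.ne'
        have h : ∀ c : ℂ, 2 * b * ∫ y : ℝ, (Polynomial.X ^ (n + 1) : Polynomial ℂ).eval (y + c) *
            Complex.exp (-b * (y + c) ^ 2) = n * ∫ y : ℝ,
              (Polynomial.X ^ (n - 1) : Polynomial ℂ).eval (y + c) *
              Complex.exp (-b * (y + c) ^ 2) := by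
          intro c
          rw [pow_succ, ← integral_derivative_mul_shifted_gaussian _ hb, ← integral_const_mul]
          refine integral_congr_ae (.of_forall fun y => ?_)
          simp [Polynomial.derivative_X_pow, mul_assoc]
        apply mul_left_cancel₀ hb'
        rw [h c, h 0, ih (n - 1) (by omega) c]
  induction p using Polynomial.induction_on' with
  | add p q hp hq =>
    have h0 := fun q : Polynomial ℂ => integrable_poly_mul_shifted_gaussian q hb 0
    simp only [add_zero] at h0
    simp only [Polynomial.eval_add, add_mul]
    rw [integral_add (integrable_poly_mul_shifted_gaussian _ hb c)
      (integrable_poly_mul_shifted_gaussian _ hb c), integral_add (h0 p) (h0 q), hp, hq]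
  | monomial n a =>
    have h := hX n c
    simp only [add_zero] at h
    simp only [← Polynomial.C_mul_X_pow_eq_monomial, Polynomial.eval_mul, Polynomial.eval_C,
      mul_assoc, integral_const_mul, h]

lemma memLp_poly_mul_gaussian (p : Polynomial ℂ) :
    MemLp (fun x : ℝ => p.eval (x : ℂ) * Complex.exp (-(1 / 2) * x ^ 2)) 2 volume := by
  rw [memLp_two_iff_integrable_sq_norm (Continuous.aestronglyMeasurable (by fun_prop))]
  refine (integrable_poly_mul_shifted_gaussian (p * p) (b := 1) one_pos 0).norm.congr
    (Filter.Eventually.of_forall fun y => ?_)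
  simp only [add_zero, ← pow_two, Polynomial.eval_pow, norm_mul, norm_pow, mul_pow]
  rw [← norm_pow (Complex.exp _), ← Complex.exp_nat_mul]
  congr 3
  push_cast
  ring

/-! ### Polynomials times the Gaussian in `L²(ℝ)` -/

/-- The class in `L²(ℝ)` of the function `p(x) e^{-x²/2}`. -/
def gaussPoly : Polynomial ℂ →ₗ[ℂ] L2R where
  toFun p := (memLp_poly_mul_gaussian p).toLp _
  map_add' p q := by
    rw [← MemLp.toLp_add]
    congr 1
    ext x
    simp [add_mul]
  map_smul' c p := by
    refine Eq.trans ?_ (MemLp.toLp_const_smul c (memLp_poly_mul_gaussian p))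
    congr 1
    ext x
    simp [mul_assoc]

lemma coeFn_gaussPoly (p : Polynomial ℂ) :
    gaussPoly p =ᵐ[volume] fun x : ℝ => p.eval (x : ℂ) * Complex.exp (-(1 / 2) * x ^ 2) :=
  MemLp.coeFn_toLp (memLp_poly_mul_gaussian p)

lemma fock_eq_gaussPoly (n : ℕ) : ∃ p, fock n = gaussPoly p := by
  refine ⟨Polynomial.C (((2 ^ n * (n.factorial : ℝ)) ^ (-(1 / 2) : ℝ) *
    Real.pi ^ (-(1 / 4) : ℝ) : ℝ) : ℂ) * (hermitePoly n).map Complex.ofRealHom, ?_⟩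
  unfold fock gaussPoly
  simp only [LinearMap.coe_mk, AddHom.coe_mk]
  congr 1
  ext x
  have h : Polynomial.eval₂ Complex.ofRealHom (x : ℂ) (hermitePoly n) =
      (((hermitePoly n).eval x : ℝ) : ℂ) := Polynomial.eval₂_at_apply Complex.ofRealHom x
  rw [Polynomial.eval_mul, Polynomial.eval_C, Polynomial.eval_map, h]
  simp [hermiteFun]

lemma fock_zero_eq_gaussPoly :
    fock 0 = gaussPoly (Polynomial.C ((Real.pi ^ (-(1 / 4) : ℝ) : ℝ) : ℂ)) := by
  unfold fock gaussPoly
  simp only [LinearMap.coe_mk, AddHom.coe_mk]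
  congr 1
  ext x
  simp [hermiteFun, hermitePoly]

lemma fockSpace_le_range_gaussPoly (N : ℕ) : fockSpace N ≤ LinearMap.range gaussPoly := by
  refine Submodule.span_le.2 ?_
  rintro _ ⟨n, -, rfl⟩
  obtain ⟨p, hp⟩ := fock_eq_gaussPoly n
  exact ⟨p, hp.symm⟩

/-! ### The polynomial profile of the Wigner function -/

/-- The profile of the Wigner function of `p(x) e^{-x²/2}`, i.e. the Wigner function without its
factor `e^{-x²-ξ²}`, as a function of `Z = x - iξ`. -/
def wignerProfile (p : Polynomial ℂ) (Z : ℂ) : ℂ :=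
  1 / (2 * Real.pi) * ∫ s : ℝ, p.eval (Z + s / 2) * (starRingEnd ℂ) (p.eval (Z - s / 2)) *
    Complex.exp (-(1 / 4) * s ^ 2)

/-- Moving the contour by `2iξ` turns the phase `e^{-iξy}` into the factor `e^{-ξ²}`. -/
lemma crossWigner_gaussPoly (p : Polynomial ℂ) (x ξ : ℝ) :
    crossWigner (gaussPoly p) (gaussPoly p) (x, ξ) =
      Real.exp (-(x ^ 2 + ξ ^ 2)) * wignerProfile p (x - Complex.I * ξ) := by
  rw [crossWigner_congr (coeFn_gaussPoly p) (coeFn_gaussPoly p), wignerProfile, mul_left_comm]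
  congr 1
  have hconj : ∀ w : ℂ, (p.map (starRingEnd ℂ)).eval ((starRingEnd ℂ) w) =
      (starRingEnd ℂ) (p.eval w) := fun w => by
    rw [Polynomial.eval_map, Polynomial.eval₂_at_apply]
  set Z : ℂ := x - Complex.I * ξ with hZ
  have hZc : (starRingEnd ℂ) Z = x + Complex.I * ξ := by simp [hZ]
  -- The product of the two polynomial factors is a polynomial in the integration variable.
  set Q : Polynomial ℂ := p.comp (Polynomial.C Z + Polynomial.C (1 / 2) * Polynomial.X) *
    (p.map (starRingEnd ℂ)).comp
      (Polynomial.C ((starRingEnd ℂ) Z) - Polynomial.C (1 / 2) * Polynomial.X) with hQ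
  have h := integral_poly_mul_shifted_gaussian Q (b := 1 / 4) (by norm_num) (2 * Complex.I * ξ)
  have h2 : ∀ s : ℝ, p.eval (Z + s / 2) * (starRingEnd ℂ) (p.eval (Z - s / 2)) *
      Complex.exp (-(1 / 4) * s ^ 2) =
      Q.eval (s : ℂ) * Complex.exp (-((1 / 4 : ℝ) : ℂ) * s ^ 2) := by
    intro s
    rw [← hconj]
    simp only [hQ, Polynomial.eval_mul, Polynomial.eval_comp, Polynomial.eval_add,
      Polynomial.eval_sub, Polynomial.eval_C, Polynomial.eval_X, map_sub, map_div₀, map_ofNat,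
      Complex.conj_ofReal]
    push_cast
    ring_nf
  simp only [h2]
  rw [← h, ← integral_const_mul]
  refine integral_congr_ae (.of_forall fun y => ?_)
  have h3 : (starRingEnd ℂ) (p.eval ((x - y / 2 : ℝ) : ℂ)) =
      (p.map (starRingEnd ℂ)).eval ((x - y / 2 : ℝ) : ℂ) := by
    rw [← hconj, Complex.conj_ofReal]
  have h4 : (starRingEnd ℂ) (Complex.exp (-(1 / 2) * ((x - y / 2 : ℝ) : ℂ) ^ 2)) =
      Complex.exp (-(1 / 2) * ((x - y / 2 : ℝ) : ℂ) ^ 2) := by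
    rw [← Complex.exp_conj]
    simp [map_ofNat]
  have h5 : Q.eval (y + 2 * Complex.I * ξ) = p.eval ((x + y / 2 : ℝ) : ℂ) *
      (p.map (starRingEnd ℂ)).eval ((x - y / 2 : ℝ) : ℂ) := by
    rw [hQ, hZc]
    simp only [Polynomial.eval_mul, Polynomial.eval_comp, Polynomial.eval_add,
      Polynomial.eval_sub, Polynomial.eval_C, Polynomial.eval_X, hZ]
    push_cast
    ring_nf
  have h6 : Complex.exp (-(Complex.I * ξ * y)) * (Complex.exp (-(1 / 2) * ((x + y / 2 : ℝ) : ℂ) ^ 2)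
      * Complex.exp (-(1 / 2) * ((x - y / 2 : ℝ) : ℂ) ^ 2)) =
      (Real.exp (-(x ^ 2 + ξ ^ 2)) : ℂ) *
        Complex.exp (-((1 / 4 : ℝ) : ℂ) * (y + 2 * Complex.I * ξ) ^ 2) := by
    rw [Complex.ofReal_exp, ← Complex.exp_add, ← Complex.exp_add, ← Complex.exp_add]
    congr 1
    push_cast
    linear_combination (ξ : ℂ) ^ 2 * Complex.I_sq
  simp only [map_mul]
  rw [h3, h4, h5]
  linear_combination p.eval ((x + y / 2 : ℝ) : ℂ) *
      (p.map (starRingEnd ℂ)).eval ((x - y / 2 : ℝ) : ℂ) * h6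

/-- The moments that occur when the profile is expanded in Taylor series. -/
def profileMoment (j k : ℕ) : ℂ :=
  1 / (2 * Real.pi) * ∫ s : ℝ, ((s : ℂ) / 2) ^ j * (-(s : ℂ) / 2) ^ k *
    Complex.exp (-(1 / 4) * s ^ 2)

lemma integrable_profileMoment (j k : ℕ) :
    Integrable (fun s : ℝ => ((s : ℂ) / 2) ^ j * (-(s : ℂ) / 2) ^ k *
      Complex.exp (-(1 / 4) * s ^ 2)) := by
  have h := integrable_poly_mul_shifted_gaussian ((Polynomial.C (1 / 2) * Polynomial.X) ^ j *
    (Polynomial.C (-1 / 2) * Polynomial.X) ^ k) (b := 1 / 4) (by norm_num) 0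
  refine h.congr (.of_forall fun s => ?_)
  simp only [Polynomial.eval_mul, Polynomial.eval_pow, Polynomial.eval_C, Polynomial.eval_X]
  push_cast
  ring_nf

lemma profileMoment_zero_zero : profileMoment 0 0 = ((1 / Real.sqrt Real.pi : ℝ) : ℂ) := by
  have h : ∫ s : ℝ, Complex.exp (-(1 / 4) * s ^ 2) = ((2 * Real.sqrt Real.pi : ℝ) : ℂ) := by
    have h1 := integral_gaussian (1 / 4)
    rw [show Real.pi / (1 / 4) = 2 ^ 2 * Real.pi by ring, Real.sqrt_mul (by norm_num),
      Real.sqrt_sq (by norm_num)] at h1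
    rw [← h1, ← integral_complex_ofReal]
    refine integral_congr_ae (.of_forall fun s => ?_)
    push_cast
    rfl
  simp only [profileMoment, pow_zero, one_mul, h]
  have hpi := Real.pi_pos
  have h2 : (1 / (2 * Real.pi) * (2 * Real.sqrt Real.pi) : ℝ) = 1 / Real.sqrt Real.pi := by
    rw [eq_div_iff (Real.sqrt_pos.2 hpi).ne', mul_assoc, mul_assoc, Real.mul_self_sqrt hpi.le]
    field_simp
  rw [← h2]
  push_cast
  ring

lemma eval_add_eq_sum_hasseDeriv (p : Polynomial ℂ) (Z s : ℂ) : p.eval (Z + s) =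
    ∑ j ∈ Finset.range (p.natDegree + 1), (Polynomial.hasseDeriv j p).eval Z * s ^ j := by
  rw [add_comm, ← Polynomial.taylor_eval, Polynomial.eval_eq_sum_range, Polynomial.natDegree_taylor]
  simp only [Polynomial.taylor_coeff]

lemma wignerProfile_eq_sum (p : Polynomial ℂ) (Z : ℂ) : wignerProfile p Z =
    ∑ j ∈ Finset.range (p.natDegree + 1), ∑ k ∈ Finset.range (p.natDegree + 1),
      (Polynomial.hasseDeriv j p).eval Z *
        (starRingEnd ℂ) ((Polynomial.hasseDeriv k p).eval Z) * profileMoment j k := by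
  have h : ∀ s : ℝ, p.eval (Z + s / 2) * (starRingEnd ℂ) (p.eval (Z - s / 2)) *
      Complex.exp (-(1 / 4) * s ^ 2) = ∑ j ∈ Finset.range (p.natDegree + 1),
        ∑ k ∈ Finset.range (p.natDegree + 1), (Polynomial.hasseDeriv j p).eval Z *
          (starRingEnd ℂ) ((Polynomial.hasseDeriv k p).eval Z) *
            (((s : ℂ) / 2) ^ j * (-(s : ℂ) / 2) ^ k * Complex.exp (-(1 / 4) * s ^ 2)) := by
    intro s
    rw [sub_eq_add_neg, eval_add_eq_sum_hasseDeriv, eval_add_eq_sum_hasseDeriv p Z (-(s / 2)),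
      map_sum, Finset.sum_mul_sum, Finset.sum_mul]
    refine Finset.sum_congr rfl fun j _ => ?_
    rw [Finset.sum_mul]
    refine Finset.sum_congr rfl fun k _ => ?_
    simp only [map_mul, map_pow, map_neg, map_div₀, map_ofNat, Complex.conj_ofReal]
    ring
  simp only [wignerProfile, h]
  rw [integral_finsetSum _ fun j _ => integrable_finsetSum _ fun k _ =>
    (integrable_profileMoment j k).const_mul _, Finset.mul_sum]
  refine Finset.sum_congr rfl fun j _ => ?_
  rw [integral_finsetSum _ fun k _ => (integrable_profileMoment j k).const_mul _, Finset.mul_sum]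
  refine Finset.sum_congr rfl fun k _ => ?_
  rw [integral_const_mul, profileMoment]
  ring

lemma continuous_wignerProfile (p : Polynomial ℂ) : Continuous (wignerProfile p) := by
  simp only [funext (wignerProfile_eq_sum p)]
  refine continuous_finsetSum _ fun j _ => continuous_finsetSum _ fun k _ => ?_
  exact ((Polynomial.continuous _).mul
    (Complex.continuous_conj.comp (Polynomial.continuous _))).mul continuous_const

lemma wignerProfile_C (a Z : ℂ) :
    wignerProfile (Polynomial.C a) Z = ((‖a‖ ^ 2 / Real.sqrt Real.pi : ℝ) : ℂ) := by
  rw [wignerProfile_eq_sum]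
  simp only [Polynomial.natDegree_C, zero_add, Finset.sum_range_one, Polynomial.hasseDeriv_zero',
    Polynomial.eval_C, profileMoment_zero_zero, Complex.mul_conj, Complex.normSq_eq_norm_sq]
  push_cast
  ring

open Filter Bornology Topology

lemma tendsto_eval_div_pow (q : Polynomial ℂ) {n : ℕ} (h : q.natDegree ≤ n) :
    Tendsto (fun Z => q.eval Z / Z ^ n) (cobounded ℂ) (𝓝 (q.coeff n)) := by
  have h1 : Tendsto (fun Z : ℂ => (q.reflect n).eval Z⁻¹) (cobounded ℂ)
      (𝓝 ((q.reflect n).eval 0)) :=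
    ((q.reflect n).continuous.tendsto 0).comp tendsto_inv₀_cobounded
  have h2 : (q.reflect n).eval 0 = q.coeff n := by
    rw [← Polynomial.coeff_zero_eq_eval_zero, Polynomial.coeff_reflect]
    simp [Polynomial.revAt_le]
  rw [h2] at h1
  refine h1.congr' ?_
  filter_upwards [eventually_ne_cobounded (0 : ℂ)] with Z hZ
  rw [eq_div_iff (pow_ne_zero n hZ)]
  let _ := invertibleOfNonzero hZ
  have := Polynomial.eval₂_reflect_mul_pow (RingHom.id ℂ) Z n q h
  rwa [invOf_eq_inv] at this

lemma coeff_hasseDeriv_natDegree (p : Polynomial ℂ) (j : ℕ) :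
    (Polynomial.hasseDeriv j p).coeff p.natDegree = if j = 0 then p.leadingCoeff else 0 := by
  split_ifs with h
  · simp [h]
  · rw [Polynomial.hasseDeriv_coeff, Polynomial.coeff_eq_zero_of_natDegree_lt (by omega), mul_zero]

/-- The leading behaviour of the profile at infinity. -/
lemma tendsto_wignerProfile (p : Polynomial ℂ) :
    Tendsto (fun Z => (wignerProfile p Z).re / ‖Z‖ ^ (2 * p.natDegree)) (cobounded ℂ)
      (𝓝 (‖p.leadingCoeff‖ ^ 2 / Real.sqrt Real.pi)) := by
  have hdeg : ∀ j, (Polynomial.hasseDeriv j p).natDegree ≤ p.natDegree := fun j =>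
    (Polynomial.natDegree_hasseDeriv_le p j).trans (Nat.sub_le _ _)
  have h : Tendsto (fun Z => wignerProfile p Z / ((‖Z‖ ^ (2 * p.natDegree) : ℝ) : ℂ)) (cobounded ℂ)
      (𝓝 (∑ j ∈ Finset.range (p.natDegree + 1), ∑ k ∈ Finset.range (p.natDegree + 1),
        (Polynomial.hasseDeriv j p).coeff p.natDegree *
        (starRingEnd ℂ) ((Polynomial.hasseDeriv k p).coeff p.natDegree) * profileMoment j k)) := by
    have h1 : ∀ Z : ℂ, wignerProfile p Z / ((‖Z‖ ^ (2 * p.natDegree) : ℝ) : ℂ) =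
        ∑ j ∈ Finset.range (p.natDegree + 1), ∑ k ∈ Finset.range (p.natDegree + 1),
          ((Polynomial.hasseDeriv j p).eval Z / Z ^ p.natDegree) * (starRingEnd ℂ)
            ((Polynomial.hasseDeriv k p).eval Z / Z ^ p.natDegree) * profileMoment j k := by
      intro Z
      have h2 : ((‖Z‖ ^ (2 * p.natDegree) : ℝ) : ℂ) =
          Z ^ p.natDegree * (starRingEnd ℂ) (Z ^ p.natDegree) := by
        rw [Complex.mul_conj, Complex.normSq_eq_norm_sq, norm_pow, pow_mul']
      rw [wignerProfile_eq_sum, Finset.sum_div]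
      refine Finset.sum_congr rfl fun j _ => ?_
      rw [Finset.sum_div]
      refine Finset.sum_congr rfl fun k _ => ?_
      rw [h2, map_div₀, div_mul_div_comm, mul_div_right_comm]
    simp only [h1]
    refine tendsto_finsetSum _ fun j _ => tendsto_finsetSum _ fun k _ => ?_
    exact ((tendsto_eval_div_pow _ (hdeg j)).mul ((Complex.continuous_conj.tendsto _).comp
      (tendsto_eval_div_pow _ (hdeg k)))).mul_const _
  have h3 : (∑ j ∈ Finset.range (p.natDegree + 1), ∑ k ∈ Finset.range (p.natDegree + 1),
      (Polynomial.hasseDeriv j p).coeff p.natDegree *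
        (starRingEnd ℂ) ((Polynomial.hasseDeriv k p).coeff p.natDegree) * profileMoment j k) =
      ((‖p.leadingCoeff‖ ^ 2 / Real.sqrt Real.pi : ℝ) : ℂ) := by
    rw [Finset.sum_eq_single_of_mem 0 (by simp), Finset.sum_eq_single_of_mem 0 (by simp)]
    · simp only [coeff_hasseDeriv_natDegree, if_true, profileMoment_zero_zero, Complex.mul_conj,
        Complex.normSq_eq_norm_sq]
      push_cast
      ring
    · intro k _ hk
      simp [coeff_hasseDeriv_natDegree, hk]
    · intro j _ hj
      simp [coeff_hasseDeriv_natDegree, hj]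
  rw [h3] at h
  have h4 := (Complex.continuous_re.tendsto _).comp h
  refine h4.congr fun Z => ?_
  simp only [Function.comp_apply, Complex.div_ofReal_re]

/-! ### Hudson's theorem -/

lemma integral_re_pos {f : ℝ → ℂ} (hf : Integrable f) (h : ∀ x, 0 < (f x).re) :
    0 < (∫ x, f x).re := by
  have h1 : (∫ x, f x).re = ∫ x, (f x).re :=
    (Complex.reCLM.integral_comp_comm hf).symm
  rw [h1, integral_pos_iff_support_of_nonneg (fun x => (h x).le) hf.re]
  have : Function.support (fun x => (f x).re) = Set.univ :=
    Set.eq_univ_of_forall fun x => (h x).ne'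
  rw [this]
  simp

lemma integrable_mul_coherent (u : L2R) (β : ℂ) :
    Integrable (fun t : ℝ => u t * Complex.exp (-(1 / 2) * t ^ 2 + β * t)) := by
  have hg : MemLp (fun t : ℝ => Complex.exp (-(1 / 2) * t ^ 2 + β * t)) 2 volume := by
    rw [memLp_two_iff_integrable_sq_norm (Continuous.aestronglyMeasurable (by fun_prop))]
    refine (integrable_poly_mul_cexp_quadratic 1 (b := 1) one_pos (2 * β)).norm.congr
      (.of_forall fun y => ?_)
    simp only [Polynomial.eval_one, one_mul]
    rw [← norm_pow, ← Complex.exp_nat_mul]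
    congr 2
    push_cast
    ring
  exact (Lp.memLp u).integrable_mul hg

/-- Averaging the Wigner function over the momentum with a Gaussian weight gives the
autoconvolution of `u` times a coherent state. -/
lemma integral_crossWigner_mul_gaussian (u : L2R) (x x₀ ξ₀ : ℝ) :
    Integrable (fun ξ : ℝ => crossWigner u u (x, ξ) * Complex.exp (-(ξ - ξ₀) ^ 2)) ∧
    ∫ ξ : ℝ, crossWigner u u (x, ξ) * Complex.exp (-(ξ - ξ₀) ^ 2) =
      ((1 / (2 * Real.sqrt Real.pi) * Real.exp (x ^ 2 - 2 * x₀ * x) : ℝ) : ℂ) *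
      ∫ y : ℝ, (u (x + y / 2) * Complex.exp (-(1 / 2) * ((x + y / 2 : ℝ) : ℂ) ^ 2 +
          (x₀ - Complex.I * ξ₀) * ((x + y / 2 : ℝ) : ℂ))) *
        (starRingEnd ℂ) (u (x - y / 2) * Complex.exp (-(1 / 2) * ((x - y / 2 : ℝ) : ℂ) ^ 2 +
          (x₀ - Complex.I * ξ₀) * ((x - y / 2 : ℝ) : ℂ))) := by
  set k : ℝ → ℂ := fun y => u (x + y / 2) * (starRingEnd ℂ) (u (x - y / 2)) with hk
  have hki : Integrable k := integrable_wignerProduct u u x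
  have hg : Integrable (fun ξ : ℝ => Complex.exp (-(ξ - ξ₀) ^ 2)) := by
    have h := integrable_poly_mul_shifted_gaussian 1 (b := 1) one_pos (-ξ₀)
    refine h.congr (.of_forall fun ξ => ?_)
    simp [sub_eq_add_neg]
  have hF : Integrable (fun q : ℝ × ℝ => Complex.exp (-(Complex.I * q.1 * q.2)) *
      (Complex.exp (-(q.1 - ξ₀) ^ 2) * k q.2)) (volume.prod volume) := by
    refine (hg.mul_prod hki).bdd_mul (c := 1) ?_ ?_
    · exact Continuous.aestronglyMeasurable (by fun_prop)
    · exact Filter.Eventually.of_forall fun q => (norm_cexp_neg_I_mul_mul q.1 q.2).le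
  have hW : ∀ ξ : ℝ, crossWigner u u (x, ξ) * Complex.exp (-(ξ - ξ₀) ^ 2) =
      1 / (2 * Real.pi) * ∫ y : ℝ, Complex.exp (-(Complex.I * ξ * y)) *
        (Complex.exp (-(ξ - ξ₀) ^ 2) * k y) := by
    intro ξ
    rw [crossWigner, mul_assoc, ← integral_mul_const]
    congr 1
    refine integral_congr_ae (.of_forall fun y => ?_)
    simp only [hk]
    ring
  simp only [hW]
  refine ⟨hF.integral_prod_left.const_mul _, ?_⟩
  have hpi := Real.pi_pos
  have hG : ∀ y : ℝ, ∫ ξ : ℝ, Complex.exp (-(Complex.I * ξ * y)) * Complex.exp (-(ξ - ξ₀) ^ 2) =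
      (Real.sqrt Real.pi : ℂ) * Complex.exp (-(Complex.I * ξ₀ * y) - y ^ 2 / 4) := by
    intro y
    have h := fourierIntegral_gaussian (b := 1) (by simp) (-y - 2 * Complex.I * ξ₀)
    have hs : ((Real.pi : ℂ) / 1) ^ (1 / 2 : ℂ) = (Real.sqrt Real.pi : ℂ) := by
      rw [Real.sqrt_eq_rpow, Complex.ofReal_cpow hpi.le]
      simp
    rw [hs] at h
    calc _ = ∫ ξ : ℝ, Complex.exp (-ξ₀ ^ 2) * (Complex.exp (Complex.I * (-y - 2 * Complex.I * ξ₀)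
          * ξ) * Complex.exp (-1 * ξ ^ 2)) := by
          refine integral_congr_ae (.of_forall fun ξ => ?_)
          simp only [← Complex.exp_add]
          congr 1
          linear_combination (2 * ξ₀ * ξ : ℂ) * Complex.I_sq
      _ = _ := by
          rw [integral_const_mul, h, mul_left_comm, ← Complex.exp_add]
          congr 2
          linear_combination (-(ξ₀ : ℂ) ^ 2) * Complex.I_sq
  rw [integral_const_mul, integral_integral_swap hF]
  have hc : (1 / (2 * Real.pi) * Real.sqrt Real.pi : ℝ) = 1 / (2 * Real.sqrt Real.pi) := by
    have h := Real.mul_self_sqrt hpi.le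
    have h0 := (Real.sqrt_pos.2 hpi).ne'
    field_simp
    nlinarith [h]
  rw [← integral_const_mul, ← integral_const_mul]
  refine integral_congr_ae (.of_forall fun y => ?_)
  have h1 : ∫ ξ : ℝ, Complex.exp (-(Complex.I * ξ * y)) * (Complex.exp (-(ξ - ξ₀) ^ 2) * k y) =
      (Real.sqrt Real.pi : ℂ) * Complex.exp (-(Complex.I * ξ₀ * y) - y ^ 2 / 4) * k y := by
    rw [← hG, ← integral_mul_const]
    simp only [mul_assoc]
  have h2 : (starRingEnd ℂ) (Complex.exp (-(1 / 2) * ((x - y / 2 : ℝ) : ℂ) ^ 2 +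
      (x₀ - Complex.I * ξ₀) * ((x - y / 2 : ℝ) : ℂ))) = Complex.exp (-(1 / 2) *
        ((x - y / 2 : ℝ) : ℂ) ^ 2 + (x₀ + Complex.I * ξ₀) * ((x - y / 2 : ℝ) : ℂ)) := by
    rw [← Complex.exp_conj]
    simp [map_ofNat]
  have h3 : Complex.exp (-(Complex.I * ξ₀ * y) - y ^ 2 / 4) =
      Complex.exp (x ^ 2 - 2 * x₀ * x) * (Complex.exp (-(1 / 2) * ((x + y / 2 : ℝ) : ℂ) ^ 2 +
          (x₀ - Complex.I * ξ₀) * ((x + y / 2 : ℝ) : ℂ)) * Complex.exp (-(1 / 2) *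
        ((x - y / 2 : ℝ) : ℂ) ^ 2 + (x₀ + Complex.I * ξ₀) * ((x - y / 2 : ℝ) : ℂ))) := by
    rw [← Complex.exp_add, ← Complex.exp_add]
    congr 1
    push_cast
    ring
  simp only
  rw [h1, map_mul, h2, h3, ← hc]
  simp only [hk]
  push_cast
  ring

/-- If the Wigner function of `u` is positive everywhere then no coherent state is orthogonal to
`u`: the Gaussian averages of the Wigner function are the squared overlaps. -/
lemma integral_mul_coherent_ne_zero (u : L2R) (h : ∀ z, 0 < (crossWigner u u z).re) (β : ℂ) :
    ∫ t : ℝ, u t * Complex.exp (-(1 / 2) * t ^ 2 + β * t) ≠ 0 := by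
  set f : ℝ → ℂ := fun t => u t * Complex.exp (-(1 / 2) * t ^ 2 + β * t) with hf
  have hfi : Integrable f := integrable_mul_coherent u β
  set g : ℝ → ℂ := fun t => (starRingEnd ℂ) (f t) with hg
  have hgi : Integrable g := (Complex.conjCLE.toContinuousLinearMap.integrable_comp hfi)
  -- The autoconvolution of `f` is positive, so its integral, which is `|∫ f|²`, is positive.
  have hconv : ∀ x : ℝ, 0 < (convolution f g (ContinuousLinearMap.mul ℝ ℂ) volume x).re := by
    intro x'
    obtain ⟨x, rfl⟩ : ∃ x, x' = 2 * x := ⟨x' / 2, by ring⟩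
    obtain ⟨hi, he⟩ := integral_crossWigner_mul_gaussian u x β.re (-β.im)
    have hpos : ∀ ξ : ℝ, 0 < (crossWigner u u (x, ξ) *
        Complex.exp (-((ξ : ℂ) - ((-β.im : ℝ) : ℂ)) ^ 2)).re := by
      intro ξ
      rw [show (-((ξ : ℂ) - ((-β.im : ℝ) : ℂ)) ^ 2) = ((-(ξ - -β.im) ^ 2 : ℝ) : ℂ) by
          push_cast; ring,
        ← Complex.ofReal_exp, Complex.re_mul_ofReal]
      exact mul_pos (h _) (Real.exp_pos _)
    have h1 := integral_re_pos hi hpos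
    rw [he, Complex.re_ofReal_mul] at h1
    have h2 := pos_of_mul_pos_right h1 (by positivity)
    have hβ : ((β.re : ℂ) - Complex.I * ((-β.im : ℝ) : ℂ)) = β := by
      apply Complex.ext <;> simp
    rw [hβ] at h2
    have h3 : convolution f g (ContinuousLinearMap.mul ℝ ℂ) volume (2 * x) =
        ((1 / 2 : ℝ) : ℂ) * ∫ y : ℝ, f (x + y / 2) * (starRingEnd ℂ) (f (x - y / 2)) := by
      have h4 := Measure.integral_comp_mul_left
        (fun t : ℝ => f (x + t) * (starRingEnd ℂ) (f (x - t))) (1 / 2)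
      have h5 := integral_add_left_eq_self (μ := volume)
        (fun t : ℝ => f t * (starRingEnd ℂ) (f (2 * x - t))) x
      have h6 : ∀ t : ℝ, 2 * x - (x + t) = x - t := fun t => by ring
      have h7 : ∀ t : ℝ, f (x + t / 2) * (starRingEnd ℂ) (f (x - t / 2)) =
          f (x + 1 / 2 * t) * (starRingEnd ℂ) (f (x - 1 / 2 * t)) := fun t => by
        rw [show t / 2 = 1 / 2 * t by ring]
      simp only [h6] at h5
      rw [integral_congr_ae (.of_forall h7), h4, h5]
      simp [convolution_def, hg]
    rw [h3, Complex.re_ofReal_mul]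
    exact mul_pos (by norm_num) h2
  have hint := integral_re_pos (hfi.integrable_convolution (ContinuousLinearMap.mul ℝ ℂ) hgi) hconv
  rw [integral_convolution _ hfi hgi] at hint
  intro h0
  rw [h0] at hint
  simp at hint

/-- The polynomial `∑ⱼ mⱼ Dʲp` with the Gaussian moments `mⱼ`, where `Dʲ` is the Hasse derivative.
Its value at `β` is the convolution of `p` with a Gaussian. -/
def gaussConv (p : Polynomial ℂ) : Polynomial ℂ :=
  ∑ j ∈ Finset.range (p.natDegree + 1),
    Polynomial.C (∫ t : ℝ, (t : ℂ) ^ j * Complex.exp (-t ^ 2)) * Polynomial.hasseDeriv j p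

lemma eval_gaussConv (p : Polynomial ℂ) (β : ℂ) :
    (gaussConv p).eval β = ∫ t : ℝ, p.eval (t + β) * Complex.exp (-t ^ 2) := by
  have hi : ∀ j : ℕ, Integrable (fun t : ℝ => (t : ℂ) ^ j * Complex.exp (-t ^ 2)) := fun j => by
    have h := integrable_poly_mul_shifted_gaussian (Polynomial.X ^ j) (b := 1) one_pos 0
    simpa using h
  have h : ∀ t : ℝ, p.eval (t + β) * Complex.exp (-t ^ 2) =
      ∑ j ∈ Finset.range (p.natDegree + 1), (Polynomial.hasseDeriv j p).eval β *
        ((t : ℂ) ^ j * Complex.exp (-t ^ 2)) := fun t => by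
    rw [add_comm, eval_add_eq_sum_hasseDeriv, Finset.sum_mul]
    simp only [mul_assoc]
  simp only [h]
  rw [integral_finsetSum _ fun j _ => (hi j).const_mul _, gaussConv, Polynomial.eval_finsetSum]
  refine Finset.sum_congr rfl fun j _ => ?_
  rw [integral_const_mul, Polynomial.eval_mul, Polynomial.eval_C, mul_comm]

lemma coeff_gaussConv_natDegree (p : Polynomial ℂ) :
    (gaussConv p).coeff p.natDegree = (Real.sqrt Real.pi : ℂ) * p.leadingCoeff := by
  have h : ∫ t : ℝ, Complex.exp (-t ^ 2) = (Real.sqrt Real.pi : ℂ) := by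
    have h1 := integral_gaussian 1
    rw [div_one] at h1
    rw [← h1, ← integral_complex_ofReal]
    refine integral_congr_ae (.of_forall fun s => ?_)
    simp
  rw [gaussConv, Polynomial.finsetSum_coeff, Finset.sum_eq_single_of_mem 0 (by simp)]
  · simp [h]
  · intro j _ hj
    simp [coeff_hasseDeriv_natDegree, hj]

/-- Hudson's theorem for polynomials times a Gaussian: if `p` is not constant, the Wigner function
of `p(x) e^{-x²/2}` is not positive everywhere. -/
lemma exists_crossWigner_gaussPoly_nonpos (p : Polynomial ℂ) (hp : p.natDegree ≠ 0) :
    ∃ z, (crossWigner (gaussPoly p) (gaussPoly p) z).re ≤ 0 := by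
  by_contra! hcon
  have hp0 : p.leadingCoeff ≠ 0 := by
    intro h
    rw [Polynomial.leadingCoeff_eq_zero] at h
    simp [h] at hp
  have hcoeff : (gaussConv p).coeff p.natDegree ≠ 0 := by
    rw [coeff_gaussConv_natDegree]
    refine mul_ne_zero ?_ hp0
    exact_mod_cast (Real.sqrt_pos.2 Real.pi_pos).ne'
  have hdeg : 0 < (gaussConv p).degree := by
    rw [← Polynomial.natDegree_pos_iff_degree_pos]
    exact (Nat.pos_of_ne_zero hp).trans_le (Polynomial.le_natDegree_of_ne_zero hcoeff)
  obtain ⟨β, hβ⟩ := Complex.exists_root hdeg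
  refine integral_mul_coherent_ne_zero _ hcon (2 * β) ?_
  have h1 : ∫ t : ℝ, gaussPoly p t * Complex.exp (-(1 / 2) * t ^ 2 + 2 * β * t) =
      Complex.exp (β ^ 2) * ∫ t : ℝ, p.eval (t : ℂ) * Complex.exp (-(t - β) ^ 2) := by
    rw [← integral_const_mul]
    refine integral_congr_ae ?_
    filter_upwards [coeFn_gaussPoly p] with t ht
    rw [ht, mul_assoc, ← Complex.exp_add, mul_left_comm, ← Complex.exp_add]
    congr 2
    ring
  have h2 := integral_poly_mul_shifted_gaussian (p.comp (Polynomial.X + Polynomial.C β))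
    (b := 1) one_pos (-β)
  simp only [Polynomial.eval_comp, Polynomial.eval_add, Polynomial.eval_X, Polynomial.eval_C,
    sub_add_cancel, ← sub_eq_add_neg, Complex.ofReal_one, neg_mul, one_mul] at h2
  rw [h1, h2, ← eval_gaussConv, hβ, mul_zero]

/-! ### Mixtures of functions with polynomial growth -/

/-- On the segment from a positive function to a function that takes a negative value but is
asymptotically a nonnegative multiple of the first, there is a nonnegative function with a zero. -/
lemma exists_segment_nonneg_with_zero {X : Type*} [TopologicalSpace X] {A B : X → ℝ}
    (hA : Continuous A) (hB : Continuous B) (hApos : ∀ x, 0 < A x) {L : ℝ} (hL : 0 ≤ L)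
    (hlim : Tendsto (fun x => B x / A x) (cocompact X) (𝓝 L)) (hneg : ∃ x, B x < 0) :
    ∃ r : ℝ, 0 < r ∧ r < 1 ∧ (∀ x, 0 ≤ (1 - r) * A x + r * B x) ∧
      ∃ x, (1 - r) * A x + r * B x = 0 := by
  obtain ⟨x₀, hx₀⟩ := hneg
  have h0 : B x₀ / A x₀ < 0 := div_neg_of_neg_of_pos hx₀ (hApos _)
  have hcont : Continuous fun x => B x / A x := hB.div hA fun x => (hApos x).ne'
  obtain ⟨x₁, hx₁⟩ := hcont.exists_forall_le' x₀
    ((hlim.eventually (lt_mem_nhds (h0.trans_le hL))).mono fun x hx => hx.le)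
  -- The combination vanishes at the minimum `m` of the quotient when `(1 - r) + r m = 0`.
  set m := B x₁ / A x₁ with hm
  have hm0 : m < 0 := (hx₁ x₀).trans_lt h0
  have hm1 : 0 < 1 - m := by linarith
  have key : ∀ x, (1 - 1 / (1 - m)) * A x + 1 / (1 - m) * B x =
      A x / (1 - m) * (B x / A x - m) := by
    intro x
    have := (hApos x).ne'
    field_simp
    ring
  refine ⟨1 / (1 - m), by positivity, by rw [div_lt_one hm1]; linarith, fun x => ?_, x₁, ?_⟩
  · rw [key]
    exact mul_nonneg (div_nonneg (hApos x).le hm1.le) (sub_nonneg.2 (hx₁ x))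
  · rw [key, ← hm, sub_self, mul_zero]

/-- `f` grows like `c |Z|^{2n}` at infinity; if `c = 0`, then `f` is of smaller order. -/
def HasGrowth (f : ℂ → ℝ) (n : ℕ) (c : ℝ) : Prop :=
  Tendsto (fun Z => f Z / ‖Z‖ ^ (2 * n)) (cobounded ℂ) (𝓝 c)

lemma HasGrowth.of_lt {f : ℂ → ℝ} {n m : ℕ} {c : ℝ} (h : HasGrowth f n c) (hnm : n < m) :
    HasGrowth f m 0 := by
  have h1 : Tendsto (fun Z : ℂ => (‖Z‖ ^ (2 * (m - n)))⁻¹) (cobounded ℂ) (𝓝 0) :=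
    ((tendsto_pow_atTop (by omega)).comp tendsto_norm_cobounded_atTop).inv_tendsto_atTop
  have h2 := h.mul h1
  rw [mul_zero] at h2
  refine h2.congr fun Z => ?_
  rw [← div_eq_mul_inv, div_div, ← pow_add, ← mul_add, Nat.add_sub_cancel' hnm.le]

lemma HasGrowth.add {f g : ℂ → ℝ} {n : ℕ} {c d : ℝ} (hf : HasGrowth f n c) (hg : HasGrowth g n d) :
    HasGrowth (fun Z => f Z + g Z) n (c + d) :=
  (Tendsto.add hf hg).congr fun _ => (add_div _ _ _).symm

lemma HasGrowth.const_mul {f : ℂ → ℝ} {n : ℕ} {c : ℝ} (hf : HasGrowth f n c) (a : ℝ) :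
    HasGrowth (fun Z => a * f Z) n (a * c) :=
  (Tendsto.const_mul a hf).congr fun _ => (mul_div_assoc _ _ _).symm

lemma HasGrowth.div {f g : ℂ → ℝ} {n : ℕ} {c d : ℝ} (hf : HasGrowth f n c) (hg : HasGrowth g n d)
    (hd : d ≠ 0) : Tendsto (fun Z => f Z / g Z) (cocompact ℂ) (𝓝 (c / d)) := by
  rw [← Metric.cobounded_eq_cocompact]
  refine (Tendsto.div hf hg hd).congr' ?_
  filter_upwards [eventually_ne_cobounded (0 : ℂ)] with Z hZ
  exact div_div_div_cancel_right₀ (pow_ne_zero _ (norm_ne_zero_iff.2 hZ)) _ _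

/-- A continuous function with positive growth coefficient is bounded below. -/
lemma HasGrowth.exists_lower_bound {f : ℂ → ℝ} {n : ℕ} {c : ℝ} (hf : HasGrowth f n c) (hc : 0 < c)
    (hcont : Continuous f) : ∃ M, 0 < M ∧ ∀ Z, -M ≤ f Z := by
  have h : ∀ᶠ Z in cocompact ℂ, 0 ≤ f Z := by
    rw [← Metric.cobounded_eq_cocompact]
    filter_upwards [hf.eventually (lt_mem_nhds hc), eventually_ne_cobounded (0 : ℂ)] with Z hZ hZ0
    have := pow_pos (norm_pos_iff.2 hZ0) (2 * n)
    exact ((div_pos_iff_of_pos_right this).1 hZ).le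
  by_cases h0 : ∃ Z₀, f Z₀ < 0
  · obtain ⟨Z₀, hZ₀⟩ := h0
    obtain ⟨Z₁, hZ₁⟩ := hcont.exists_forall_le' Z₀ (h.mono fun Z hZ => hZ₀.le.trans hZ)
    refine ⟨-f Z₁, by linarith [hZ₁ Z₀], fun Z => by simpa using hZ₁ Z⟩
  · push Not at h0
    exact ⟨1, one_pos, fun Z => by linarith [h0 Z]⟩

section Mixture

variable {ι : Type*} [Fintype ι]

/-- The mixture of the functions `w i` with the weights `μ i`. -/
def mixture (w : ι → ℂ → ℝ) (μ : ι → ℝ) (Z : ℂ) : ℝ := ∑ i, μ i * w i Z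

lemma mixture_add (w : ι → ℂ → ℝ) (μ ν : ι → ℝ) (Z : ℂ) :
    mixture w (μ + ν) Z = mixture w μ Z + mixture w ν Z := by
  simp [mixture, add_mul, Finset.sum_add_distrib]

lemma mixture_smul (w : ι → ℂ → ℝ) (a : ℝ) (μ : ι → ℝ) (Z : ℂ) :
    mixture w (a • μ) Z = a * mixture w μ Z := by
  simp [mixture, mul_assoc, Finset.mul_sum]

/-- The weights whose mixture is nonnegative with a zero, and the vertices of the simplex whose
function is positive. -/
def extremalWeights [DecidableEq ι] (w : ι → ℂ → ℝ) : Set (ι → ℝ) :=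
  {μ | μ ∈ stdSimplex ℝ ι ∧ (∀ Z, 0 ≤ mixture w μ Z) ∧ ∃ Z, mixture w μ Z = 0} ∪
    {μ | ∃ i, μ = Pi.single i 1 ∧ ∀ Z, 0 < w i Z}

variable {w : ι → ℂ → ℝ} {n : ι → ℕ} {c : ι → ℝ}

lemma continuous_mixture (hw : ∀ i, Continuous (w i)) (μ : ι → ℝ) : Continuous (mixture w μ) :=
  continuous_finsetSum _ fun i _ => continuous_const.mul (hw i)

/-- There is no cancellation in the leading growth of a mixture with nonnegative weights, so two
mixtures are comparable at infinity when the support of one contains that of the other. -/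
lemma tendsto_mixture_div_mixture (hg : ∀ i, HasGrowth (w i) (n i) (c i)) (hc : ∀ i, 0 < c i)
    {μ ν : ι → ℝ} (hμ : μ ∈ stdSimplex ℝ ι) (hν : ∀ i, 0 ≤ ν i) (hsupp : ∀ i, μ i = 0 → ν i = 0) :
    ∃ L, 0 ≤ L ∧ Tendsto (fun Z => mixture w ν Z / mixture w μ Z) (cocompact ℂ) (𝓝 L) := by
  classical
  obtain ⟨k, hk⟩ : ∃ k, μ k ≠ 0 := by
    by_contra! h
    have := hμ.2
    simp [h] at this
  obtain ⟨j, hj, hmax⟩ := Finset.exists_max_image (Finset.univ.filter fun i => μ i ≠ 0) n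
    ⟨k, by simpa using hk⟩
  -- `j` has the highest order of growth in the support of `μ`.
  have hgrow : ∀ τ : ι → ℝ, (∀ i, μ i = 0 → τ i = 0) → HasGrowth (mixture w τ) (n j)
      (∑ i, τ i * if n i = n j then c i else 0) := by
    intro τ hτ
    have h : ∀ i, Tendsto (fun Z => τ i * w i Z / ‖Z‖ ^ (2 * n j)) (cobounded ℂ)
        (𝓝 (τ i * if n i = n j then c i else 0)) := by
      intro i
      by_cases hi : μ i = 0
      · simp [hτ i hi]
      · split_ifs with h
        · exact (h ▸ hg i : HasGrowth (w i) (n j) (c i)).const_mul (τ i)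
        · exact ((hg i).of_lt (lt_of_le_of_ne (hmax i (by simpa using hi)) h)).const_mul (τ i)
    refine (tendsto_finsetSum Finset.univ fun i _ => h i).congr fun Z => ?_
    rw [← Finset.sum_div, mixture]
  have hnn : ∀ i, 0 ≤ (if n i = n j then c i else 0) := fun i => by
    split_ifs
    · exact (hc i).le
    · exact le_rfl
  have hpos : 0 < ∑ i, μ i * if n i = n j then c i else 0 := by
    refine Finset.sum_pos' (fun i _ => mul_nonneg (hμ.1 i) (hnn i)) ⟨j, Finset.mem_univ _, ?_⟩
    simp only [if_true]
    exact mul_pos (lt_of_le_of_ne (hμ.1 j) (Ne.symm (by simpa using hj))) (hc j)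
  exact ⟨_, div_nonneg (Finset.sum_nonneg fun i _ => mul_nonneg (hν i) (hnn i)) hpos.le,
    (hgrow ν hsupp).div (hgrow μ fun i h => h) hpos.ne'⟩

variable [DecidableEq ι]

lemma sum_single_sub_single (i j : ι) (t : ℝ) :
    ∑ l, (t • (Pi.single i 1 - Pi.single j 1 : ι → ℝ)) l = 0 := by
  simp [← Finset.mul_sum, Finset.sum_sub_distrib]

/-- Shift weight from `j` to `i`, until the mixture acquires a zero or the weight of `j` vanishes. -/
lemma exists_shift_mem (hw : ∀ i, Continuous (w i)) (hg : ∀ i, HasGrowth (w i) (n i) (c i))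
    (hc : ∀ i, 0 < c i) {C : Set (ι → ℝ)} (hC : extremalWeights w ⊆ C) {μ : ι → ℝ}
    (hμ : μ ∈ stdSimplex ℝ ι) (hpos : ∀ Z, 0 < mixture w μ Z)
    (ih : ∀ ν ∈ stdSimplex ℝ ι, (∀ Z, 0 ≤ mixture w ν Z) →
      (Finset.univ.filter fun i => ν i ≠ 0).card < (Finset.univ.filter fun i => μ i ≠ 0).card →
      ν ∈ C) {i j : ι} (hij : i ≠ j) (hi : μ i ≠ 0) (hj : μ j ≠ 0) :
    ∃ t : ℝ, 0 < t ∧ μ + t • (Pi.single i 1 - Pi.single j 1 : ι → ℝ) ∈ C := by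
  have hj0 : 0 < μ j := lt_of_le_of_ne (hμ.1 j) hj.symm
  set d : ι → ℝ := Pi.single i 1 - Pi.single j 1 with hd
  have hval : ∀ (t : ℝ) l, (μ + t • d) l =
      if l = i then μ i + t else if l = j then μ j - t else μ l := by
    intro t l
    by_cases h1 : l = i
    · subst h1
      simp [hd, hij]
    · by_cases h2 : l = j
      · subst h2
        simp [hd, h1, sub_eq_add_neg]
      · simp [hd, h1, h2]
  have hsimplex : ∀ t : ℝ, 0 ≤ t → t ≤ μ j → μ + t • d ∈ stdSimplex ℝ ι := by
    intro t ht0 ht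
    refine ⟨fun l => ?_, ?_⟩
    · rw [hval]
      split_ifs
      · linarith [hμ.1 i]
      · linarith
      · exact hμ.1 l
    · simp only [Pi.add_apply]
      rw [Finset.sum_add_distrib, sum_single_sub_single, hμ.2, add_zero]
  have hBs := hsimplex (μ j) hj0.le le_rfl
  have hsupp : ∀ l, μ l = 0 → (μ + μ j • d) l = 0 := by
    intro l hl
    have h1 : l ≠ i := fun h => hi (h ▸ hl)
    have h2 : l ≠ j := fun h => hj (h ▸ hl)
    rw [hval, if_neg h1, if_neg h2, hl]
  by_cases hB : ∀ Z, 0 ≤ mixture w (μ + μ j • d) Z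
  · refine ⟨μ j, hj0, ih _ hBs hB (Finset.card_lt_card ?_)⟩
    rw [Finset.ssubset_iff_of_subset]
    · refine ⟨j, by simpa using hj, ?_⟩
      simp only [Finset.mem_filter, Finset.mem_univ, true_and, not_not]
      rw [hval, if_neg hij.symm, if_pos rfl, sub_self]
    · intro l
      simp only [Finset.mem_filter, Finset.mem_univ, true_and]
      exact fun h h' => h (hsupp l h')
  · push Not at hB
    obtain ⟨L, hL, hlim⟩ := tendsto_mixture_div_mixture hg hc hμ hBs.1 hsupp
    obtain ⟨r, hr0, hr1, hnn, Z, hZ⟩ := exists_segment_nonneg_with_zero (continuous_mixture hw _)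
      (continuous_mixture hw _) hpos hL hlim hB
    have hmix : ∀ Z, mixture w (μ + (r * μ j) • d) Z =
        (1 - r) * mixture w μ Z + r * mixture w (μ + μ j • d) Z := by
      intro Z
      simp only [mixture_add, mixture_smul]
      ring
    refine ⟨r * μ j, by positivity, hC (Or.inl ⟨hsimplex _ (by positivity) ?_, fun Z => ?_, Z, ?_⟩)⟩
    · nlinarith
    · rw [hmix]
      exact hnn Z
    · rw [hmix]
      exact hZ

/-- Every nonnegative mixture is a convex combination of extremal ones, by induction on the number
of nonzero weights. -/
theorem mem_convexHull_extremalWeights (hw : ∀ i, Continuous (w i))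
    (hg : ∀ i, HasGrowth (w i) (n i) (c i)) (hc : ∀ i, 0 < c i) {μ : ι → ℝ}
    (hμ : μ ∈ stdSimplex ℝ ι) (hnn : ∀ Z, 0 ≤ mixture w μ Z) :
    μ ∈ convexHull ℝ (extremalWeights w) := by
  induction hk : (Finset.univ.filter fun i => μ i ≠ 0).card using Nat.strong_induction_on
    generalizing μ with
  | _ k ih =>
    by_cases hz : ∃ Z, mixture w μ Z = 0
    · exact subset_convexHull ℝ _ (Or.inl ⟨hμ, hnn, hz⟩)
    push Not at hz
    have hpos : ∀ Z, 0 < mixture w μ Z := fun Z => lt_of_le_of_ne (hnn Z) (hz Z).symm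
    obtain ⟨i, hi⟩ : ∃ i, μ i ≠ 0 := by
      by_contra! h
      have := hμ.2
      simp [h] at this
    by_cases hj : ∃ j, i ≠ j ∧ μ j ≠ 0
    · obtain ⟨j, hij, hj⟩ := hj
      have ih' : ∀ ν ∈ stdSimplex ℝ ι, (∀ Z, 0 ≤ mixture w ν Z) →
          (Finset.univ.filter fun i => ν i ≠ 0).card < (Finset.univ.filter fun i => μ i ≠ 0).card →
          ν ∈ convexHull ℝ (extremalWeights w) := fun ν h1 h2 h3 => ih _ (hk ▸ h3) h1 h2 rfl
      obtain ⟨t, ht, h1⟩ := exists_shift_mem hw hg hc (subset_convexHull ℝ _) hμ hpos ih' hij hi hj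
      obtain ⟨s, hs, h2⟩ :=
        exists_shift_mem hw hg hc (subset_convexHull ℝ _) hμ hpos ih' hij.symm hj hi
      have := convex_convexHull ℝ (extremalWeights w) h1 h2 (a := s / (t + s)) (b := t / (t + s))
        (by positivity) (by positivity) (by field_simp; ring)
      convert this using 1
      ext l
      simp only [Pi.add_apply, Pi.smul_apply, Pi.sub_apply, smul_eq_mul]
      field_simp
      ring
    · push Not at hj
      have hμi : μ = Pi.single i (μ i) := by
        ext l
        by_cases h : l = i
        · subst h
          simp
        · simp [h, hj l (Ne.symm h)]
      have h1 : μ i = 1 := by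
        have := hμ.2
        rw [hμi] at this
        simpa using this
      rw [h1] at hμi
      refine subset_convexHull ℝ _ (Or.inr ⟨i, hμi, fun Z => ?_⟩)
      have := hpos Z
      rw [hμi] at this
      simpa [mixture, Pi.single_apply] using this

end Mixture

/-! ### Spectral decomposition and the trace norm -/

section FiniteDimensional

variable {E : Type*} [NormedAddCommGroup E] [InnerProductSpace ℂ E]

/-- The operator `∑ᵢ μᵢ |eᵢ⟩⟨eᵢ|` as a function of the real weights `μ`. -/
def diagOp {ι : Type*} [Fintype ι] (e : ι → E) : (ι → ℝ) →ₗ[ℝ] (E →L[ℂ] E) where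
  toFun μ := ∑ i, (μ i : ℂ) • InnerProductSpace.rankOne ℂ (e i) (e i)
  map_add' μ ν := by
    simp [add_smul, Finset.sum_add_distrib]
  map_smul' a μ := by
    simp [mul_smul, Finset.smul_sum]

lemma diagOp_apply {ι : Type*} [Fintype ι] (e : ι → E) (μ : ι → ℝ) :
    diagOp e μ = ∑ i, (μ i : ℂ) • InnerProductSpace.rankOne ℂ (e i) (e i) := rfl

lemma diagOp_single {ι : Type*} [Fintype ι] [DecidableEq ι] (e : ι → E) (i : ι) :
    diagOp e (Pi.single i 1) = InnerProductSpace.rankOne ℂ (e i) (e i) := by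
  simp [diagOp_apply, Pi.single_apply, apply_ite]

lemma isPositive_diagOp {ι : Type*} [Fintype ι] (e : ι → E) {μ : ι → ℝ}
    (hμ : ∀ i, 0 ≤ μ i) : (diagOp e μ).IsPositive := by
  rw [diagOp_apply]
  refine Finset.sum_induction _ ContinuousLinearMap.IsPositive (fun _ _ h h' => h.add h')
    ContinuousLinearMap.isPositive_zero fun i _ => ?_
  exact (InnerProductSpace.isPositive_rankOne_self (e i)).smul_of_nonneg
    (by exact_mod_cast hμ i)

lemma map_real_combination (L : (E →L[ℂ] E) →ₗ[ℂ] ℂ) (a b : ℝ) (A B : E →L[ℂ] E) :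
    L (a • A + b • B) = a * L A + b * L B := by
  rw [← Complex.coe_smul, ← Complex.coe_smul, map_add, map_smul, map_smul, smul_eq_mul, smul_eq_mul]

lemma rankOne_smul_self {γ : ℂ} (hγ : ‖γ‖ = 1) (f : E) :
    InnerProductSpace.rankOne ℂ (γ • f) (γ • f) = InnerProductSpace.rankOne ℂ f f := by
  ext v
  rw [InnerProductSpace.rankOne_apply, InnerProductSpace.rankOne_apply, inner_smul_left, smul_smul,
    mul_right_comm, mul_comm _ γ, Complex.mul_conj, Complex.normSq_eq_norm_sq, hγ]
  simp

/-- The trace as a linear functional. -/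
def trLin : (E →L[ℂ] E) →ₗ[ℂ] ℂ where
  toFun := tr
  map_add' A B := by simp [tr]
  map_smul' a A := by simp [tr]

lemma convex_densityMatrices [CompleteSpace E] : Convex ℝ (densityMatrices E) := by
  intro ρ hρ σ hσ a b ha hb hab
  have hpos : (a • ρ + b • σ).IsPositive := by
    rw [← ContinuousLinearMap.nonneg_iff_isPositive]
    exact add_nonneg
      (smul_nonneg ha ((ContinuousLinearMap.nonneg_iff_isPositive _).2 hρ.2))
      (smul_nonneg hb ((ContinuousLinearMap.nonneg_iff_isPositive _).2 hσ.2))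
  refine ⟨⟨hpos.isSelfAdjoint, ?_⟩, hpos⟩
  have h1 : trLin ρ = 1 := hρ.1.2
  have h2 : trLin σ = 1 := hσ.1.2
  refine (map_real_combination trLin a b ρ σ).trans ?_
  rw [h1, h2, mul_one, mul_one, ← Complex.ofReal_add, hab, Complex.ofReal_one]

variable [FiniteDimensional ℂ E]

lemma tr_rankOne (x y : E) : tr (InnerProductSpace.rankOne ℂ x y) = ⟪y, x⟫_ℂ :=
  InnerProductSpace.trace_rankOne x y

lemma tr_diagOp {ι : Type*} [Fintype ι] {e : ι → E} (he : ∀ i, ‖e i‖ = 1) (μ : ι → ℝ) :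
    tr (diagOp e μ) = ((∑ i, μ i : ℝ) : ℂ) := by
  change trLin (diagOp e μ) = _
  rw [diagOp_apply, map_sum, Complex.ofReal_sum]
  refine Finset.sum_congr rfl fun i _ => ?_
  rw [map_smul]
  change (μ i : ℂ) • tr _ = _
  rw [tr_rankOne, inner_self_eq_norm_sq_to_K, he i]
  simp

lemma exists_eq_diagOp {T : E →L[ℂ] E} (hT : T.IsPositive) :
    ∃ (e : OrthonormalBasis (Fin (Module.finrank ℂ E)) ℂ E) (μ : Fin (Module.finrank ℂ E) → ℝ),
      (∀ i, 0 ≤ μ i) ∧ T = diagOp e μ := by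
  have hs : (T : E →ₗ[ℂ] E).IsSymmetric := hT.isSymmetric
  have hTe : ∀ i, T (hs.eigenvectorBasis rfl i) =
      (hs.eigenvalues rfl i : ℂ) • hs.eigenvectorBasis rfl i :=
    fun i => hs.apply_eigenvectorBasis rfl i
  refine ⟨hs.eigenvectorBasis rfl, hs.eigenvalues rfl, fun i => ?_, ?_⟩
  · exact (LinearMap.IsPositive.nonneg_eigenvalues
      (ContinuousLinearMap.isPositive_toLinearMap_iff T |>.2 hT) rfl i)
  · refine ContinuousLinearMap.coe_injective
      ((hs.eigenvectorBasis rfl).toBasis.ext fun i => ?_)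
    simp only [OrthonormalBasis.coe_toBasis, ContinuousLinearMap.coe_coe]
    rw [hTe, diagOp_apply, sum_apply]
    rw [Finset.sum_eq_single i]
    · simp
    · intro j _ hj
      simp [(hs.eigenvectorBasis rfl).orthonormal.2 hj]
    · simp

lemma norm_le_re_tr {T : E →L[ℂ] E} (hT : T.IsPositive) : ‖T‖ ≤ (tr T).re := by
  obtain ⟨e, μ, hμ, rfl⟩ := exists_eq_diagOp hT
  rw [tr_diagOp e.orthonormal.1, Complex.ofReal_re, diagOp_apply]
  refine (norm_sum_le _ _).trans (Finset.sum_le_sum fun i _ => ?_)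
  rw [norm_smul, InnerProductSpace.norm_rankOne, e.orthonormal.1 i, Complex.norm_real,
    Real.norm_of_nonneg (hμ i)]
  simp

lemma re_tr_le_finrank_mul_norm (T : E →L[ℂ] E) : (tr T).re ≤ Module.finrank ℂ E * ‖T‖ := by
  have h : tr T = ∑ i, ⟪stdOrthonormalBasis ℂ E i, T (stdOrthonormalBasis ℂ E i)⟫_ℂ :=
    LinearMap.trace_eq_sum_inner (T : E →ₗ[ℂ] E) (stdOrthonormalBasis ℂ E)
  rw [h, Complex.re_sum]
  calc _ ≤ ∑ _i : Fin (Module.finrank ℂ E), ‖T‖ := by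
        refine Finset.sum_le_sum fun i _ => (Complex.re_le_norm _).trans ?_
        refine (norm_inner_le_norm _ _).trans ?_
        have h1 := (stdOrthonormalBasis ℂ E).orthonormal.1 i
        have h2 := T.le_opNorm (stdOrthonormalBasis ℂ E i)
        rw [h1] at h2 ⊢
        simpa using h2
    _ = _ := by simp

variable [CompleteSpace E]

lemma norm_le_traceNorm (A : E →L[ℂ] E) : ‖A‖ ≤ traceNorm A := by
  rw [← CFC.norm_abs (a := A)]
  exact norm_le_re_tr ((ContinuousLinearMap.nonneg_iff_isPositive _).1 (CFC.abs_nonneg A))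

lemma traceNorm_le_finrank_mul_norm (A : E →L[ℂ] E) :
    traceNorm A ≤ Module.finrank ℂ E * ‖A‖ := by
  rw [← CFC.norm_abs (a := A)]
  exact re_tr_le_finrank_mul_norm _

lemma IsClosed.isTraceNormClosed {C : Set (E →L[ℂ] E)} (hC : IsClosed C) :
    IsTraceNormClosed C := by
  intro ρ h
  rw [← hC.closure_eq, Metric.mem_closure_iff]
  intro ε hε
  obtain ⟨η, hη, hlt⟩ := h ε hε
  exact ⟨η, hη, by rw [dist_eq_norm]; exact (norm_le_traceNorm _).trans_lt hlt⟩

lemma IsTraceNormClosed.isClosed {C : Set (E →L[ℂ] E)} (hC : IsTraceNormClosed C) :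
    IsClosed C := by
  refine isClosed_of_closure_subset fun ρ hρ => hC ρ fun ε hε => ?_
  have hd : (0 : ℝ) < Module.finrank ℂ E + 1 := by positivity
  obtain ⟨η, hη, hlt⟩ := Metric.mem_closure_iff.1 hρ (ε / (Module.finrank ℂ E + 1))
    (div_pos hε hd)
  refine ⟨η, hη, (traceNorm_le_finrank_mul_norm _).trans_lt ?_⟩
  rw [dist_eq_norm, lt_div_iff₀ hd] at hlt
  nlinarith [norm_nonneg (ρ - η)]

/-- The closed convex hull for the trace norm is the topological one, since the trace norm and the
operator norm are equivalent in finite dimension. -/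
lemma closedConvHull_eq (S : Set (E →L[ℂ] E)) : closedConvHull S = closure (convexHull ℝ S) := by
  apply Set.Subset.antisymm
  · exact Set.sInter_subset_of_mem ⟨(subset_convexHull ℝ S).trans subset_closure,
      (convex_convexHull ℝ S).closure, IsClosed.isTraceNormClosed isClosed_closure⟩
  · refine Set.subset_sInter fun C hC => ?_
    exact closure_minimal (convexHull_min hC.1 hC.2.1) hC.2.2.isClosed

lemma isClosed_densityMatrices : IsClosed (densityMatrices E) := by
  have h1 : IsClosed {ρ : E →L[ℂ] E | tr ρ = 1} :=
    isClosed_eq (LinearMap.continuous_of_finiteDimensional (trLin (E := E))) continuous_const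
  have h2 : IsClosed {ρ : E →L[ℂ] E | 0 ≤ ρ} := by
    have h3 : {ρ : E →L[ℂ] E | 0 ≤ ρ} = {ρ | IsSelfAdjoint ρ} ∩
        ⋂ x : E, {ρ | 0 ≤ ρ.reApplyInnerSelf x} := by
      ext ρ
      simp only [Set.mem_ofPred_eq, Set.mem_inter_iff, Set.mem_iInter,
        ContinuousLinearMap.nonneg_iff_isPositive, ContinuousLinearMap.isPositive_def,
        ContinuousLinearMap.isSelfAdjoint_iff_isSymmetric]
    rw [h3]
    refine (isClosed_eq continuous_star continuous_id).inter (isClosed_iInter fun x => ?_)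
    refine isClosed_le continuous_const ?_
    simp only [ContinuousLinearMap.reApplyInnerSelf]
    fun_prop
  have h4 : densityMatrices E = {ρ : E →L[ℂ] E | tr ρ = 1} ∩ {ρ | 0 ≤ ρ} := by
    ext ρ
    simp only [densityMatrices, unitTraceOps, Set.mem_ofPred_eq, Set.mem_inter_iff,
      ContinuousLinearMap.nonneg_iff_isPositive]
    exact ⟨fun h => ⟨h.1.2, h.2⟩, fun h => ⟨⟨h.2.isSelfAdjoint, h.1⟩, h.2⟩⟩
  rw [h4]
  exact h1.inter h2

lemma diagOp_mem_densityMatrices {ι : Type*} [Fintype ι] {e : ι → E} (he : ∀ i, ‖e i‖ = 1)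
    {μ : ι → ℝ} (hμ : μ ∈ stdSimplex ℝ ι) : diagOp e μ ∈ densityMatrices E := by
  have h := isPositive_diagOp e hμ.1
  exact ⟨⟨h.isSelfAdjoint, by rw [tr_diagOp he, hμ.2, Complex.ofReal_one]⟩, h⟩

lemma exists_eq_diagOp_of_mem_densityMatrices {ρ : E →L[ℂ] E} (hρ : ρ ∈ densityMatrices E) :
    ∃ e : OrthonormalBasis (Fin (Module.finrank ℂ E)) ℂ E, ∃ μ ∈ stdSimplex ℝ _,
      ρ = diagOp e μ := by
  obtain ⟨e, μ, hμ, rfl⟩ := exists_eq_diagOp hρ.2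
  have h := hρ.1.2
  rw [tr_diagOp e.orthonormal.1] at h
  exact ⟨e, μ, ⟨hμ, by exact_mod_cast h⟩, rfl⟩

end FiniteDimensional

/-! ### Wigner-positive states -/

/-- The real profile of the Wigner function of `p(x) e^{-x²/2}`. -/
def realProfile (p : Polynomial ℂ) (Z : ℂ) : ℝ := (wignerProfile p Z).re

lemma crossWigner_gaussPoly_eq_ofReal (p : Polynomial ℂ) (z : ℝ × ℝ) :
    crossWigner (gaussPoly p) (gaussPoly p) z =
      ((Real.exp (-(z.1 ^ 2 + z.2 ^ 2)) * realProfile p (z.1 - Complex.I * z.2) : ℝ) : ℂ) := by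
  apply Complex.ext
  · rw [crossWigner_gaussPoly p z.1 z.2, Complex.re_ofReal_mul, Complex.ofReal_re, realProfile]
  · rw [crossWigner_self_im, Complex.ofReal_im]

lemma continuous_realProfile (p : Polynomial ℂ) : Continuous (realProfile p) :=
  Complex.continuous_re.comp (continuous_wignerProfile p)

lemma hasGrowth_realProfile (p : Polynomial ℂ) : HasGrowth (realProfile p) p.natDegree
    (‖p.leadingCoeff‖ ^ 2 / Real.sqrt Real.pi) := tendsto_wignerProfile p

lemma growthCoeff_pos {p : Polynomial ℂ} (hp : p ≠ 0) :
    0 < ‖p.leadingCoeff‖ ^ 2 / Real.sqrt Real.pi :=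
  div_pos (pow_pos (norm_pos_iff.2 (Polynomial.leadingCoeff_ne_zero.2 hp)) 2)
    (Real.sqrt_pos.2 Real.pi_pos)

lemma exists_realProfile_nonpos (p : Polynomial ℂ) (hp : p.natDegree ≠ 0) :
    ∃ Z, realProfile p Z ≤ 0 := by
  obtain ⟨z, hz⟩ := exists_crossWigner_gaussPoly_nonpos p hp
  rw [crossWigner_gaussPoly_eq_ofReal, Complex.ofReal_re] at hz
  exact ⟨_, nonpos_of_mul_nonpos_right hz (Real.exp_pos _)⟩

lemma exists_gaussPoly_eq_smul_fock_zero (p : Polynomial ℂ) (hp : p.natDegree = 0) :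
    ∃ γ : ℂ, gaussPoly p = γ • fock 0 := by
  have hpi : ((Real.pi ^ (-(1 / 4) : ℝ) : ℝ) : ℂ) ≠ 0 :=
    Complex.ofReal_ne_zero.2 (Real.rpow_pos_of_pos Real.pi_pos _).ne'
  refine ⟨p.coeff 0 / ((Real.pi ^ (-(1 / 4) : ℝ) : ℝ) : ℂ), ?_⟩
  rw [fock_zero_eq_gaussPoly, ← map_smul, Polynomial.smul_C, smul_eq_mul, div_mul_cancel₀ _ hpi,
    ← Polynomial.eq_C_of_natDegree_eq_zero hp]

lemma norm_fock_zero : ‖fock 0‖ = 1 := by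
  have h : ⟪fock 0, fock 0⟫_ℂ = 1 := by
    rw [L2.inner_def]
    have h1 : ∀ᵐ x : ℝ, ⟪fock 0 x, fock 0 x⟫_ℂ =
        ((Real.pi ^ (-(1 / 2) : ℝ) * Real.exp (-1 * x ^ 2) : ℝ) : ℂ) := by
      filter_upwards [(memLp_hermiteFun 0).coeFn_toLp] with x hx
      have hx' : fock 0 x = hermiteFun 0 x := hx
      have hval : hermiteFun 0 x =
          ((Real.pi ^ (-(1 / 4) : ℝ) * Real.exp (-(1 / 2) * x ^ 2) : ℝ) : ℂ) := by
        simp [hermiteFun, hermitePoly]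
      rw [hx', hval, RCLike.inner_apply, Complex.conj_ofReal, ← Complex.ofReal_mul,
        mul_mul_mul_comm, ← Real.rpow_add Real.pi_pos, ← Real.exp_add]
      congr 3
      · norm_num
      · ring
    rw [integral_congr_ae h1, integral_complex_ofReal, integral_const_mul, integral_gaussian,
      div_one, Real.sqrt_eq_rpow, ← Real.rpow_add Real.pi_pos]
    norm_num
  have h2 : ‖fock 0‖ ^ 2 = 1 := by
    rw [norm_sq_eq_re_inner (𝕜 := ℂ), h]
    simp
  exact (pow_eq_one_iff_of_nonneg (norm_nonneg _) two_ne_zero).1 h2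

lemma fock_zero_mem_of_eq_smul {H : Submodule ℂ L2R} {u : H} {γ : ℂ} (hu : ‖u‖ = 1)
    (hγ : (u : L2R) = γ • fock 0) : fock 0 ∈ H := by
  have hγ0 : γ ≠ 0 := by
    rintro rfl
    rw [zero_smul] at hγ
    rw [Submodule.coe_norm, hγ, norm_zero] at hu
    exact zero_ne_one hu
  rw [← inv_smul_smul₀ hγ0 (fock 0), ← hγ]
  exact H.smul_mem _ u.2

lemma rankOne_eq_of_eq_smul_fock_zero {H : Submodule ℂ L2R} (h0 : fock 0 ∈ H) {u : H} {γ : ℂ}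
    (hu : ‖u‖ = 1) (hγ : (u : L2R) = γ • fock 0) : InnerProductSpace.rankOne ℂ u u =
      InnerProductSpace.rankOne ℂ (⟨fock 0, h0⟩ : H) (⟨fock 0, h0⟩ : H) := by
  have hu' : u = γ • (⟨fock 0, h0⟩ : H) := Subtype.ext hγ
  have hn : ‖γ‖ = 1 := by
    rw [hu', norm_smul, Submodule.coe_norm, norm_fock_zero, mul_one] at hu
    exact hu
  rw [hu']
  exact rankOne_smul_self hn _

section Segments

variable {E : Type*} [NormedAddCommGroup E] [InnerProductSpace ℂ E]

lemma exists_unit_orthogonal [FiniteDimensional ℂ E] (f : E) (hd : 2 ≤ Module.finrank ℂ E) :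
    ∃ ψ : E, ‖ψ‖ = 1 ∧ ⟪f, ψ⟫_ℂ = 0 := by
  have h1 := Submodule.finrank_add_finrank_orthogonal (Submodule.span ℂ {f})
  have h2 := finrank_span_le_card (R := ℂ) ({f} : Set E)
  rw [Set.toFinset_singleton, Finset.card_singleton] at h2
  have h3 : 0 < Module.finrank ℂ (Submodule.span ℂ {f})ᗮ := by omega
  have := Module.finrank_pos_iff.1 h3
  obtain ⟨⟨v, hv⟩, hv0⟩ := exists_ne (0 : (Submodule.span ℂ {f})ᗮ)
  have hv0' : v ≠ 0 := fun h => hv0 (Subtype.ext h)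
  refine ⟨((‖v‖⁻¹ : ℝ) : ℂ) • v, ?_, ?_⟩
  · rw [norm_smul, Complex.norm_real, norm_inv, norm_norm,
      inv_mul_cancel₀ (norm_ne_zero_iff.2 hv0')]
  · rw [inner_smul_right, Submodule.mem_orthogonal_singleton_iff_inner_right.1 hv, mul_zero]

lemma norm_cos_smul_add_sin_smul
    {f ψ : E} (hf : ‖f‖ = 1) (hψ : ‖ψ‖ = 1) (hort : ⟪f, ψ⟫_ℂ = 0) (θ : ℝ) :
    ‖(Real.cos θ : ℂ) • f + (Real.sin θ : ℂ) • ψ‖ = 1 := by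
  have h := norm_add_sq_eq_norm_sq_add_norm_sq_of_inner_eq_zero ((Real.cos θ : ℂ) • f)
    ((Real.sin θ : ℂ) • ψ) (by rw [inner_smul_left, inner_smul_right, hort]; simp)
  rw [norm_smul, norm_smul, hf, hψ, Complex.norm_real, Complex.norm_real, mul_one, mul_one,
    Real.norm_eq_abs, Real.norm_eq_abs, ← pow_two, ← pow_two, ← pow_two, sq_abs, sq_abs,
    Real.cos_sq_add_sin_sq] at h
  exact (pow_eq_one_iff_of_nonneg (norm_nonneg _) two_ne_zero).1 h

/-- The state `cos²θ |f⟩⟨f| + sin²θ |ψ⟩⟨ψ|`. -/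
def mixedState (f ψ : E) (θ : ℝ) :
    E →L[ℂ] E :=
  ((Real.cos θ ^ 2 : ℝ) : ℂ) • InnerProductSpace.rankOne ℂ f f +
    ((Real.sin θ ^ 2 : ℝ) : ℂ) • InnerProductSpace.rankOne ℂ ψ ψ

/-- The pure state of the vector `cos θ f + sin θ ψ`. -/
def superposedState (f ψ : E) (θ : ℝ) :
    E →L[ℂ] E :=
  InnerProductSpace.rankOne ℂ ((Real.cos θ : ℂ) • f + (Real.sin θ : ℂ) • ψ)
    ((Real.cos θ : ℂ) • f + (Real.sin θ : ℂ) • ψ)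

lemma continuous_superposedState
    (f ψ : E) : Continuous (superposedState f ψ) := by
  have h : ∀ θ, superposedState f ψ θ =
      ((Real.cos θ * Real.cos θ : ℝ) : ℂ) • InnerProductSpace.rankOne ℂ f f +
      ((Real.sin θ * Real.cos θ : ℝ) : ℂ) • InnerProductSpace.rankOne ℂ ψ f +
      (((Real.cos θ * Real.sin θ : ℝ) : ℂ) • InnerProductSpace.rankOne ℂ f ψ +
      ((Real.sin θ * Real.sin θ : ℝ) : ℂ) • InnerProductSpace.rankOne ℂ ψ ψ) := by
    intro θ
    ext v
    simp only [superposedState, InnerProductSpace.rankOne_apply, inner_add_left, inner_smul_left,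
      Complex.conj_ofReal, add_apply, smul_apply]
    push_cast
    module
  rw [funext h]
  fun_prop

lemma segment_mixedState_superposedState (f ψ : E) (θ r : ℝ) :
    (((1 - r) * Real.cos θ ^ 2 : ℝ) : ℂ) • InnerProductSpace.rankOne ℂ f f +
        (((1 - r) * Real.sin θ ^ 2 : ℝ) : ℂ) • InnerProductSpace.rankOne ℂ ψ ψ +
        (r : ℂ) • superposedState f ψ θ =
      (1 - r) • mixedState f ψ θ + r • superposedState f ψ θ := by
  rw [mixedState, ← Complex.coe_smul, ← Complex.coe_smul, smul_add, smul_smul, smul_smul,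
    Complex.ofReal_mul, Complex.ofReal_mul]

lemma rankOne_mem_closure_of_segment_mem {f ψ : E} {S : Set (E →L[ℂ] E)}
    (hS : ∀ᶠ θ : ℝ in 𝓝[>] 0, ∃ r : ℝ, 0 ≤ r ∧ r ≤ 1 ∧
      (1 - r) • mixedState f ψ θ + r • superposedState f ψ θ ∈ S) :
    InnerProductSpace.rankOne ℂ f f ∈ closure S := by
  have hmixed : Continuous (mixedState f ψ) := by
    unfold mixedState
    fun_prop
  have hm0 : mixedState f ψ 0 = InnerProductSpace.rankOne ℂ f f := by simp [mixedState]
  have hs0 : superposedState f ψ 0 = InnerProductSpace.rankOne ℂ f f := by simp [superposedState]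
  refine Metric.mem_closure_iff.2 fun ε hε => ?_
  have h1 : ∀ᶠ θ : ℝ in 𝓝[>] 0,
      mixedState f ψ θ ∈ Metric.ball (InnerProductSpace.rankOne ℂ f f) ε :=
    nhdsWithin_le_nhds (hmixed.tendsto 0 (hm0 ▸ Metric.ball_mem_nhds _ hε))
  have h2 : ∀ᶠ θ : ℝ in 𝓝[>] 0,
      superposedState f ψ θ ∈ Metric.ball (InnerProductSpace.rankOne ℂ f f) ε :=
    nhdsWithin_le_nhds
      ((continuous_superposedState f ψ).tendsto 0 (hs0 ▸ Metric.ball_mem_nhds _ hε))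
  obtain ⟨θ, h1, h2, r, hr0, hr1, hr⟩ :=
    (h1.and (h2.and hS)).exists
  refine ⟨_, hr, ?_⟩
  rw [dist_comm]
  exact convex_ball _ _ h1 h2 (sub_nonneg.2 hr1) hr0 (by ring)

end Segments

section States

variable (H : Submodule ℂ L2R) [FiniteDimensional ℂ H]

lemma wigner_diagOp {ι : Type*} [Fintype ι] {e : ι → H} {p : ι → Polynomial ℂ}
    (hp : ∀ i, gaussPoly (p i) = e i) (μ : ι → ℝ) (z : ℝ × ℝ) :
    wigner H (diagOp e μ) z = ((Real.exp (-(z.1 ^ 2 + z.2 ^ 2)) *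
      mixture (fun i => realProfile (p i)) μ (z.1 - Complex.I * z.2) : ℝ) : ℂ) := by
  rw [← wignerLin_apply, diagOp_apply, map_sum, mixture, Finset.mul_sum, Complex.ofReal_sum]
  refine Finset.sum_congr rfl fun i _ => ?_
  rw [map_smul, wignerLin_apply, wigner_rankOne, ← hp i, crossWigner_gaussPoly_eq_ofReal]
  push_cast
  rw [smul_eq_mul]
  ring

lemma exists_phase_point (Z : ℂ) : ∃ z : ℝ × ℝ, (z.1 : ℂ) - Complex.I * z.2 = Z :=
  ⟨(Z.re, -Z.im), by apply Complex.ext <;> simp⟩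

variable {H} in
lemma diagOp_mem_wignerPositive {ι : Type*} [Fintype ι] {e : ι → H} {p : ι → Polynomial ℂ}
    (he : ∀ i, ‖e i‖ = 1) (hp : ∀ i, gaussPoly (p i) = e i) {μ : ι → ℝ}
    (hμ : μ ∈ stdSimplex ℝ ι) (hnn : ∀ Z, 0 ≤ mixture (fun i => realProfile (p i)) μ Z) :
    diagOp e μ ∈ wignerPositive H := by
  refine ⟨diagOp_mem_densityMatrices he hμ, fun z => ?_⟩
  rw [wigner_diagOp H hp]
  exact Complex.zero_le_real.2 (mul_nonneg (Real.exp_pos _).le (hnn _))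

variable {H} in
lemma diagOp_mem_wignerPositiveNodal {ι : Type*} [Fintype ι] {e : ι → H} {p : ι → Polynomial ℂ}
    (he : ∀ i, ‖e i‖ = 1) (hp : ∀ i, gaussPoly (p i) = e i) {μ : ι → ℝ}
    (hμ : μ ∈ stdSimplex ℝ ι) (hnn : ∀ Z, 0 ≤ mixture (fun i => realProfile (p i)) μ Z)
    (hz : ∃ Z, mixture (fun i => realProfile (p i)) μ Z = 0) :
    diagOp e μ ∈ wignerPositiveNodal H := by
  obtain ⟨Z, hZ⟩ := hz
  obtain ⟨z, rfl⟩ := exists_phase_point Z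
  refine ⟨diagOp_mem_wignerPositive he hp hμ hnn, z, ?_⟩
  change wigner H (diagOp e μ) z = 0
  rw [wigner_diagOp H hp, hZ, mul_zero, Complex.ofReal_zero]

lemma convex_wignerPositive : Convex ℝ (wignerPositive H) := by
  intro ρ hρ σ hσ a b ha hb hab
  refine ⟨convex_densityMatrices hρ.1 hσ.1 ha hb hab, fun z => ?_⟩
  have h : wigner H (a • ρ + b • σ) z = a * wigner H ρ z + b * wigner H σ z :=
    map_real_combination (wignerLin H z) a b ρ σ
  rw [h]
  exact add_nonneg (mul_nonneg (Complex.zero_le_real.2 ha) (hρ.2 z))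
    (mul_nonneg (Complex.zero_le_real.2 hb) (hσ.2 z))

lemma isClosed_wignerPositive : IsClosed (wignerPositive H) := by
  have h : wignerPositive H = densityMatrices H ∩ ⋂ z, {ρ | 0 ≤ wignerLin H z ρ} := by
    ext ρ
    simp [wignerPositive, wignerLin_apply]
  rw [h]
  exact isClosed_densityMatrices.inter (isClosed_iInter fun z =>
    isClosed_le continuous_const (LinearMap.continuous_of_finiteDimensional (wignerLin H z)))

variable {H}

/-- Every Wigner-positive state is a convex combination of Wigner-positive states with a zero and
of pure Gaussian states. -/
lemma wignerPositive_subset_convexHull (hH : H ≤ LinearMap.range gaussPoly) :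
    wignerPositive H ⊆ convexHull ℝ (wignerPositiveNodal H ∪
      {ρ | ∃ (u : H) (γ : ℂ), ‖u‖ = 1 ∧ (u : L2R) = γ • fock 0 ∧
        ρ = InnerProductSpace.rankOne ℂ u u}) := by
  intro ρ hρ
  obtain ⟨e, μ, hμ, rfl⟩ := exists_eq_diagOp_of_mem_densityMatrices hρ.1
  choose p hp using fun i => hH (e i).2
  have hp0 : ∀ i, p i ≠ 0 := fun i h => by
    have h1 := hp i
    rw [h, map_zero] at h1
    exact e.orthonormal.ne_zero i (Subtype.ext h1.symm)
  have hnn : ∀ Z, 0 ≤ mixture (fun i => realProfile (p i)) μ Z := by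
    intro Z
    obtain ⟨z, rfl⟩ := exists_phase_point Z
    have h := hρ.2 z
    rw [wigner_diagOp H hp, Complex.zero_le_real] at h
    exact nonneg_of_mul_nonneg_right h (Real.exp_pos _)
  have hmem := mem_convexHull_extremalWeights (fun i => continuous_realProfile (p i))
    (fun i => hasGrowth_realProfile (p i)) (fun i => growthCoeff_pos (hp0 i)) hμ hnn
  have himage := Set.mem_image_of_mem (diagOp e) hmem
  rw [LinearMap.image_convexHull] at himage
  refine convexHull_mono ?_ himage
  rintro _ ⟨ν, (⟨hν, hν0, hνz⟩ | ⟨i, rfl, hi⟩), rfl⟩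
  · exact Or.inl (diagOp_mem_wignerPositiveNodal e.orthonormal.1 hp hν hν0 hνz)
  · right
    have hdeg : (p i).natDegree = 0 := by
      by_contra h
      obtain ⟨Z, hZ⟩ := exists_realProfile_nonpos (p i) h
      exact absurd (hi Z) (not_lt.2 hZ)
    obtain ⟨γ, hγ⟩ := exists_gaussPoly_eq_smul_fock_zero (p i) hdeg
    exact ⟨e i, γ, e.orthonormal.1 i, by rw [← hp i, hγ], diagOp_single _ _⟩

lemma rankOne_fock_zero_mem_wignerPositive (h0 : fock 0 ∈ H) :
    InnerProductSpace.rankOne ℂ (⟨fock 0, h0⟩ : H) (⟨fock 0, h0⟩ : H) ∈ wignerPositive H := by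
  have h := diagOp_mem_wignerPositive (H := H) (ι := Unit) (e := fun _ => ⟨fock 0, h0⟩)
    (p := fun _ => Polynomial.C ((Real.pi ^ (-(1 / 4) : ℝ) : ℝ) : ℂ)) (μ := Pi.single () 1)
    (fun _ => norm_fock_zero) (fun _ => fock_zero_eq_gaussPoly.symm)
    (single_mem_stdSimplex ℝ ()) (fun Z => by
      simp only [mixture, Finset.univ_unique, Finset.sum_singleton, realProfile, wignerProfile_C]
      simp only [PUnit.default_eq_unit, Pi.single_eq_same, one_mul, Complex.ofReal_re]
      positivity)
  rwa [diagOp_single] at h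

/-- For small angles the mixed state has a positive Wigner function while the pure one, which is
not Gaussian, does not; both have the same growth, so there is a state with a zero in between. -/
lemma exists_segment_mem_wignerPositiveNodal {f ψ : H} (hf : (f : L2R) = fock 0) (hψ : ‖ψ‖ = 1)
    (hort : ⟪f, ψ⟫_ℂ = 0) (hH : H ≤ LinearMap.range gaussPoly) :
    ∀ᶠ θ : ℝ in 𝓝[>] 0, ∃ r : ℝ, 0 ≤ r ∧ r ≤ 1 ∧
      (1 - r) • mixedState f ψ θ + r • superposedState f ψ θ ∈ wignerPositiveNodal H := by
  have hf1 : ‖f‖ = 1 := by rw [Submodule.coe_norm, hf, norm_fock_zero]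
  obtain ⟨p, hp⟩ := hH ψ.2
  set a : ℂ := ((Real.pi ^ (-(1 / 4) : ℝ) : ℝ) : ℂ) with ha
  have ha0 : a ≠ 0 := Complex.ofReal_ne_zero.2 (Real.rpow_pos_of_pos Real.pi_pos _).ne'
  have hfa : gaussPoly (Polynomial.C a) = f := by rw [hf, fock_zero_eq_gaussPoly]
  have hdeg : p.natDegree ≠ 0 := by
    intro h
    obtain ⟨γ, hγ⟩ := exists_gaussPoly_eq_smul_fock_zero p h
    have h1 : ψ = γ • f := Subtype.ext (by rw [← hp, hγ, Submodule.coe_smul, hf])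
    rw [h1] at hort
    have h3 := (inner_smul_right (𝕜 := ℂ) f f γ).symm.trans hort
    rw [inner_self_eq_norm_sq_to_K, hf1] at h3
    have h2 : γ = 0 := by simpa using h3
    rw [h1, h2, zero_smul, norm_zero] at hψ
    exact zero_ne_one hψ
  have hp0 : p ≠ 0 := by
    rintro rfl
    simp at hdeg
  obtain ⟨M, hM, hbound⟩ := (hasGrowth_realProfile p).exists_lower_bound (growthCoeff_pos hp0)
    (continuous_realProfile p)
  set c₀ : ℝ := ‖a‖ ^ 2 / Real.sqrt Real.pi with hc₀
  have hc₀pos : 0 < c₀ := div_pos (pow_pos (norm_pos_iff.2 ha0) 2) (Real.sqrt_pos.2 Real.pi_pos)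
  have hprof : ∀ Z, realProfile (Polynomial.C a) Z = c₀ := fun Z => by
    rw [realProfile, wignerProfile_C, Complex.ofReal_re]
  have hev : ∀ᶠ θ : ℝ in 𝓝[>] 0, 0 < Real.cos θ ^ 2 * c₀ - Real.sin θ ^ 2 * M := by
    have hcont : Continuous fun θ : ℝ => Real.cos θ ^ 2 * c₀ - Real.sin θ ^ 2 * M := by fun_prop
    exact nhdsWithin_le_nhds ((hcont.tendsto 0).eventually (lt_mem_nhds (by simpa using hc₀pos)))
  have hlt : ∀ᶠ θ : ℝ in 𝓝[>] 0, θ < Real.pi :=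
    nhdsWithin_le_nhds (gt_mem_nhds Real.pi_pos)
  filter_upwards [hev, hlt, self_mem_nhdsWithin] with θ hθ hθπ hθ0
  have hsin : 0 < Real.sin θ := Real.sin_pos_of_pos_of_lt_pi hθ0 hθπ
  set φ : H := (Real.cos θ : ℂ) • f + (Real.sin θ : ℂ) • ψ with hφ
  set q : Polynomial ℂ := Polynomial.C (Real.cos θ * a) + Polynomial.C (Real.sin θ : ℂ) * p with hq
  have hqφ : gaussPoly q = φ := by
    rw [hq, hφ, map_add, Polynomial.C_mul, Polynomial.C_mul', Polynomial.C_mul', map_smul,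
      map_smul, hp, hfa]
    rfl
  have hsinC : (Real.sin θ : ℂ) ≠ 0 := Complex.ofReal_ne_zero.2 hsin.ne'
  have hqdeg : q.natDegree = p.natDegree := by
    rw [hq, Polynomial.natDegree_C_add, Polynomial.natDegree_C_mul hsinC]
  have hq0 : q ≠ 0 := by
    intro h
    rw [h, Polynomial.natDegree_zero] at hqdeg
    exact hdeg hqdeg.symm
  -- The three pure states whose mixtures form the segment.
  set e : Fin 3 → H := ![f, ψ, φ] with he
  set P : Fin 3 → Polynomial ℂ := ![Polynomial.C a, p, q] with hP
  have he1 : ∀ i, ‖e i‖ = 1 := by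
    intro i
    fin_cases i
    · exact hf1
    · exact hψ
    · exact norm_cos_smul_add_sin_smul hf1 hψ hort θ
  have hPe : ∀ i, gaussPoly (P i) = e i := by
    intro i
    fin_cases i
    · exact hfa
    · exact hp
    · exact hqφ
  set A : ℂ → ℝ := fun Z => Real.cos θ ^ 2 * realProfile (Polynomial.C a) Z +
    Real.sin θ ^ 2 * realProfile p Z with hA
  have hApos : ∀ Z, 0 < A Z := by
    intro Z
    simp only [hA, hprof]
    nlinarith [hbound Z, sq_nonneg (Real.sin θ)]
  have hAcont : Continuous A := (continuous_const.mul (continuous_realProfile _)).add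
    (continuous_const.mul (continuous_realProfile _))
  have hAgrowth : HasGrowth A p.natDegree
      (Real.cos θ ^ 2 * 0 + Real.sin θ ^ 2 * (‖p.leadingCoeff‖ ^ 2 / Real.sqrt Real.pi)) := by
    refine HasGrowth.add (HasGrowth.const_mul ?_ _) ((hasGrowth_realProfile p).const_mul _)
    exact (hasGrowth_realProfile (Polynomial.C a)).of_lt
      (by rw [Polynomial.natDegree_C]; exact Nat.pos_of_ne_zero hdeg)
  have hBgrowth : HasGrowth (realProfile q) p.natDegree
      (‖q.leadingCoeff‖ ^ 2 / Real.sqrt Real.pi) := hqdeg ▸ hasGrowth_realProfile q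
  have hcA : 0 < Real.cos θ ^ 2 * 0 +
      Real.sin θ ^ 2 * (‖p.leadingCoeff‖ ^ 2 / Real.sqrt Real.pi) := by
    rw [mul_zero, zero_add]
    exact mul_pos (pow_pos hsin 2) (growthCoeff_pos hp0)
  have hlim := hBgrowth.div hAgrowth hcA.ne'
  -- It remains to find a weight for which the profile of the mixture is nonnegative with a zero.
  suffices h : ∃ r : ℝ, 0 ≤ r ∧ r ≤ 1 ∧ (∀ Z, 0 ≤ (1 - r) * A Z + r * realProfile q Z) ∧
      ∃ Z, (1 - r) * A Z + r * realProfile q Z = 0 by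
    obtain ⟨r, hr0, hr1, hnn, hz⟩ := h
    refine ⟨r, hr0, hr1, ?_⟩
    set μ : Fin 3 → ℝ := ![(1 - r) * Real.cos θ ^ 2, (1 - r) * Real.sin θ ^ 2, r] with hμ
    have hμs : μ ∈ stdSimplex ℝ (Fin 3) := by
      refine ⟨fun i => ?_, ?_⟩
      · fin_cases i
        · exact mul_nonneg (sub_nonneg.2 hr1) (sq_nonneg _)
        · exact mul_nonneg (sub_nonneg.2 hr1) (sq_nonneg _)
        · exact hr0
      · rw [Fin.sum_univ_three]
        change (1 - r) * Real.cos θ ^ 2 + (1 - r) * Real.sin θ ^ 2 + r = 1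
        rw [← mul_add, Real.cos_sq_add_sin_sq]
        ring
    have hmix : ∀ Z, mixture (fun i => realProfile (P i)) μ Z =
        (1 - r) * A Z + r * realProfile q Z := by
      intro Z
      rw [mixture, Fin.sum_univ_three]
      change (1 - r) * Real.cos θ ^ 2 * realProfile (Polynomial.C a) Z +
        (1 - r) * Real.sin θ ^ 2 * realProfile p Z + r * realProfile q Z = _
      simp only [hA]
      ring
    have hop : diagOp e μ = (1 - r) • mixedState f ψ θ + r • superposedState f ψ θ := by
      rw [diagOp_apply, Fin.sum_univ_three]
      exact segment_mixedState_superposedState f ψ θ r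
    rw [← hop]
    refine diagOp_mem_wignerPositiveNodal he1 hPe hμs (fun Z => ?_) ?_
    · rw [hmix]
      exact hnn Z
    · obtain ⟨Z, hZ⟩ := hz
      exact ⟨Z, by rw [hmix, hZ]⟩
  by_cases hB : ∀ Z, 0 ≤ realProfile q Z
  · obtain ⟨Z, hZ⟩ := exists_realProfile_nonpos q (hqdeg ▸ hdeg)
    refine ⟨1, zero_le_one, le_rfl, fun Z => ?_, Z, ?_⟩
    · simpa using hB Z
    · simpa using le_antisymm hZ (hB Z)
  · push Not at hB
    obtain ⟨r, hr0, hr1, h1, h2⟩ := exists_segment_nonneg_with_zero hAcont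
      (continuous_realProfile q) hApos (div_nonneg (growthCoeff_pos hq0).le hcA.le) hlim hB
    exact ⟨r, hr0.le, hr1.le, h1, h2⟩

lemma rankOne_fock_zero_mem_closure (hH : H ≤ LinearMap.range gaussPoly) (h0 : fock 0 ∈ H)
    (hd : 2 ≤ Module.finrank ℂ H) :
    InnerProductSpace.rankOne ℂ (⟨fock 0, h0⟩ : H) (⟨fock 0, h0⟩ : H) ∈
      closure (wignerPositiveNodal H) := by
  set f : H := ⟨fock 0, h0⟩ with hf
  obtain ⟨ψ, hψ, hort⟩ := exists_unit_orthogonal f hd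
  exact rankOne_mem_closure_of_segment_mem
    (exists_segment_mem_wignerPositiveNodal rfl hψ hort hH)

end States

end WignerPositive

end

theorem mainTheorem6 (N : ℕ) (H : Submodule ℂ WignerPositive.L2R)
    (hH : H ≤ WignerPositive.fockSpace N) :
    haveI : FiniteDimensional ℂ H := Submodule.finiteDimensional_of_le hH
    (∀ h0 : WignerPositive.fock 0 ∈ H,
      WignerPositive.wignerPositive H =
        WignerPositive.convHull (WignerPositive.wignerPositiveNodal H ∪
          {InnerProductSpace.rankOne ℂ (⟨WignerPositive.fock 0, h0⟩ : H)
            (⟨WignerPositive.fock 0, h0⟩ : H)})) ∧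
    (WignerPositive.fock 0 ∉ H →
      WignerPositive.wignerPositive H =
        WignerPositive.convHull (WignerPositive.wignerPositiveNodal H)) ∧
    (2 ≤ Module.finrank ℂ H →
      WignerPositive.wignerPositive H =
        WignerPositive.closedConvHull (WignerPositive.wignerPositiveNodal H)) := by
  have : FiniteDimensional ℂ H := Submodule.finiteDimensional_of_le hH
  have hH' := hH.trans (WignerPositive.fockSpace_le_range_gaussPoly N)
  have hsub : WignerPositive.wignerPositiveNodal H ⊆ WignerPositive.wignerPositive H :=
    fun ρ hρ => hρ.1
  have hconv := WignerPositive.convex_wignerPositive H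
  have hdecomp := WignerPositive.wignerPositive_subset_convexHull hH'
  have part1 : ∀ h0 : WignerPositive.fock 0 ∈ H, WignerPositive.wignerPositive H =
      WignerPositive.convHull (WignerPositive.wignerPositiveNodal H ∪
        {InnerProductSpace.rankOne ℂ (⟨WignerPositive.fock 0, h0⟩ : H)
          (⟨WignerPositive.fock 0, h0⟩ : H)}) := by
    intro h0
    refine (hdecomp.trans (convexHull_mono (Set.union_subset_union_right _ ?_))).antisymm
      (convexHull_min (Set.union_subset hsub ?_) hconv)
    · rintro _ ⟨u, γ, hu, hγ, rfl⟩
      exact WignerPositive.rankOne_eq_of_eq_smul_fock_zero h0 hu hγ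
    · exact Set.singleton_subset_iff.2 (WignerPositive.rankOne_fock_zero_mem_wignerPositive h0)
  have part2 : WignerPositive.fock 0 ∉ H → WignerPositive.wignerPositive H =
      WignerPositive.convHull (WignerPositive.wignerPositiveNodal H) := by
    intro h0
    refine (hdecomp.trans (convexHull_mono (Set.union_subset subset_rfl ?_))).antisymm
      (convexHull_min hsub hconv)
    rintro _ ⟨u, γ, hu, hγ, -⟩
    exact absurd (WignerPositive.fock_zero_mem_of_eq_smul hu hγ) h0
  refine ⟨part1, part2, fun hd => ?_⟩
  rw [WignerPositive.closedConvHull_eq]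
  refine Set.Subset.antisymm ?_
    (closure_minimal (convexHull_min hsub hconv) (WignerPositive.isClosed_wignerPositive H))
  by_cases h0 : WignerPositive.fock 0 ∈ H
  · rw [part1 h0]
    refine convexHull_min (Set.union_subset ((subset_convexHull ℝ _).trans subset_closure) ?_)
      (convex_convexHull ℝ _).closure
    exact Set.singleton_subset_iff.2 (closure_mono (subset_convexHull ℝ _)
      (WignerPositive.rankOne_fock_zero_mem_closure hH' h0 hd))
  · rw [part2 h0]
    exact subset_closure
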